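/- Let $S\subset\mathbb R^3$ be a smooth ($C^\infty$) embedded surface without boundary, not necessarily closed. Let $P\subseteq S$ be a regular patch of $S$. That is, $P$ is a compact subset of $S$ with smooth boundary within $S$, so that around each of its points there is a smooth local parametrization $(u^0,u^1)\mapsto\varphi(u^0,u^1)$ of $S$ in which $P$ is given by $u^0\le 0$. Let $\Gamma=P\cap\overline{S\setminus P}$ be its contour, the boundary of $P$ relative to $S$. For each $p\in P$ let $\mathbf N(p)$ be a unit normal to $S$ at $p$. Let $B^\alpha_\alpha(p)$ be the mean curvature of $S$ at $p$ consistent with the direction of $\mathbf N(p)$, defined as follows. In any local parametrization $\varphi$, put $\mathbf S_\alpha=\partial\varphi/\partial u^\alpha$, $S_{\alpha\beta}=\mathbf S_\alpha\cdot\mathbf S_\beta$, $(S^{\alpha\beta})=(S_{\alpha\beta})^{-1}$ and $B_{\alpha\beta}=\mathbf N\cdot\partial\mathbf S_\alpha/\partial u^\beta$. Then $$B^\alpha_\alpha=\sum_{\alpha,\beta}S^{\alpha\beta}B_{\alpha\beta},$$ the trace (not half the trace), which does not depend on the parametrization. For each $p\in\Gamma$ let $\mathbf n(p)$ be the exterior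 unit normal to $\Gamma$ within $S$: the unit vector that is tangent to $S$, orthogonal to $\Gamma$, and points out of $P$. Then $\mathbf N B^\alpha_\alpha$ is integrable over $P$ with respect to area, $\mathbf n$ is integrable over $\Gamma$ with respect to arc length, and $$\int_P \mathbf N B^\alpha_\alpha\,dS=\int_\Gamma \mathbf n\,d\Gamma .$$ -/

import Mathlib

open MeasureTheory Set
open scoped ContDiff

/-- The Euclidean plane of parameters. -/
abbrev Plane : Type := EuclideanSpace ℝ (Fin 2)

/-- The ambient Euclidean space. -/
abbrev Space : Type := EuclideanSpace ℝ (Fin 3)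

/-- A smooth local parametrization of the set `S ⊆ ℝ³`: a smooth immersion of an open set `source`
of the plane, which is a homeomorphism from `source` onto a relatively open subset of `S`. -/
structure SurfaceChart (S : Set Space) where
  toFun : Plane → Space
  source : Set Plane
  isOpen_source : IsOpen source
  smooth : ContDiffOn ℝ ∞ toFun source
  immersion : ∀ u ∈ source, Function.Injective (fderiv ℝ toFun u)
  embedding : Topology.IsEmbedding (source.domRestrict toFun)
  image_open : ∃ W : Set Space, IsOpen W ∧ toFun '' source = S ∩ W

/-- `S` is a smooth embedded surface in `ℝ³` (without boundary, not necessarily closed). -/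
def IsSmoothSurface (S : Set Space) : Prop :=
  ∀ p ∈ S, ∃ (φ : SurfaceChart S), ∃ u ∈ φ.source, φ.toFun u = p

namespace SurfaceChart

variable {S : Set Space}

/-- The covariant basis vector `S_α = ∂φ/∂u^α`, as a function of the parameters. -/
noncomputable def basis (φ : SurfaceChart S) (α : Fin 2) (u : Plane) : Space :=
  fderiv ℝ φ.toFun u (EuclideanSpace.single α 1)

/-- The covariant metric tensor `S_{αβ} = S_α ⬝ S_β`. -/
noncomputable def metric (φ : SurfaceChart S) (u : Plane) : Matrix (Fin 2) (Fin 2) ℝ :=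
  Matrix.of fun α β => inner ℝ (φ.basis α u) (φ.basis β u)

/-- The curvature tensor `B_{αβ} = ν ⬝ ∂S_α/∂u^β` with respect to a normal vector `ν`. -/
noncomputable def curvature (φ : SurfaceChart S) (ν : Space) (u : Plane) :
    Matrix (Fin 2) (Fin 2) ℝ :=
  Matrix.of fun α β => inner ℝ ν (fderiv ℝ (φ.basis α) u (EuclideanSpace.single β 1))

/-- The trace `B^α_α = S^{αβ} B_{αβ}`, where `S^{αβ}` is the inverse of the metric tensor. -/
noncomputable def traceCurvature (φ : SurfaceChart S) (ν : Space) (u : Plane) : ℝ :=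
  ∑ α, ∑ β, (φ.metric u)⁻¹ α β * φ.curvature ν u α β

/-- The chart `φ` is adapted to `P`: in the parameters, `P` is the half plane `u⁰ ≤ 0`. -/
def IsAdapted (φ : SurfaceChart S) (P : Set Space) : Prop :=
  ∀ u ∈ φ.source, (φ.toFun u ∈ P ↔ u 0 ≤ 0)

end SurfaceChart

/-- `v` is tangent to `S` at `p`: it is a combination of the covariant basis vectors at `p`. -/
def IsTangentTo (S : Set Space) (p v : Space) : Prop :=
  ∃ (φ : SurfaceChart S), ∃ u ∈ φ.source, φ.toFun u = p ∧
    ∃ w : Plane, v = fderiv ℝ φ.toFun u w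

/-- `ν` is one of the two unit normals of `S` at `p`. -/
def IsUnitNormal (S : Set Space) (p ν : Space) : Prop :=
  ‖ν‖ = 1 ∧ ∀ v, IsTangentTo S p v → inner ℝ ν v = 0

open Classical in
/-- The mean curvature `B^α_α` of `S` at `p`, consistent with the direction of the unit normal `ν`
at `p`. It does not depend on the chart around `p` in which it is computed. -/
noncomputable def meanCurvature (S : Set Space) (p ν : Space) : ℝ :=
  if h : ∃ x : SurfaceChart S × Plane, x.2 ∈ x.1.source ∧ x.1.toFun x.2 = p then
    h.choose.1.traceCurvature ν h.choose.2
  else 0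

/-- `P` is a regular patch of the surface `S`: a compact region in `S` whose boundary within `S` is
smooth. Around each of its points, `P` is a half plane `u⁰ ≤ 0` in suitable parameters (around an
interior point, the parameters may stay in `u⁰ < 0`). -/
structure IsRegularPatch (S P : Set Space) : Prop where
  subset : P ⊆ S
  isCompact : IsCompact P
  exists_adapted : ∀ p ∈ P, ∃ φ : SurfaceChart S, φ.IsAdapted P ∧
    ∃ u ∈ φ.source, φ.toFun u = p

/-- The contour of the patch `P`: its boundary relative to `S`. -/
def contour (S P : Set Space) : Set Space :=
  P ∩ closure (S \ P)

/-- `n` is the exterior unit normal, within `S`, to the contour of the patch `P` at its point `p`: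
a unit vector, tangent to `S`, orthogonal to the contour (whose tangent is `S_1` in an adapted
chart), and pointing out of `P`, that is to the side of `S_0`. -/
def IsOutwardConormal (S P : Set Space) (p n : Space) : Prop :=
  ‖n‖ = 1 ∧ IsTangentTo S p n ∧
    ∃ φ : SurfaceChart S, φ.IsAdapted P ∧ ∃ u ∈ φ.source, φ.toFun u = p ∧
      inner ℝ n (φ.basis 1 u) = 0 ∧ 0 < inner ℝ n (φ.basis 0 u)

/-! In a chart, let `S^α = S^{αβ} S_β` be the dual basis and `√S` the square root of the determinant
of the metric. The fields `√S S^α` (`flux`) satisfy `∑ ∂_α(√S S^α) = √S B^α_α N`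
(`sum_fderiv_flux`). The tangential components cancel by the formula for the derivative of `√S` and
the symmetry of `∂_β S_α`. In the normal component only the curvature survives. The field `N` is
never differentiated, and `N B^α_α` is even in `N`, so neither continuity of `N` nor an orientation
is needed.

If the patch is `u⁰ ≤ 0`, the divergence theorem on the half plane leaves the integral of `√S S^0`
over the line `u⁰ = 0`. There `√S S^0 = |S_1| n` (`flux_zero_eq_norm_smul`), which is the conormal
times the arc length density.

A smooth partition of unity `ρ_i` subordinate to adapted charts makes this global. The product rule
adds to each local identity the integral of the tangential gradient of `ρ_i`
(`integral_smul_meanCurvature_add_tangentialGradient`). These extra terms sum to zero because `∑ ρ_i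
= 1` near the patch. The area formula converts Hausdorff integrals to parameters, with density `√S`
for area and `|S_1|` for arc length. -/

/-! ### The area formula for injective immersions -/

section AreaFormula

open Measure Module Filter
open scoped Topology NNReal ENNReal

/-- On `s` the map `f` factors through `g` by a `K`-Lipschitz map `k`, and such maps enlarge
`d`-dimensional measure by at most `K ^ d`. Applied in both directions, this compares an immersion
with its linear part. -/
theorem hausdorffMeasure_image_le_of_dist_le {X Y Z : Type*} [Nonempty X] [MetricSpace Y]
    [MeasurableSpace Y] [BorelSpace Y] [MetricSpace Z] [MeasurableSpace Z] [BorelSpace Z]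
    {f : X → Y} {g : X → Z} {s : Set X} {K : ℝ≥0}
    (h : ∀ x ∈ s, ∀ y ∈ s, dist (f x) (f y) ≤ K * dist (g x) (g y)) (d : ℕ) :
    μHE[d] (f '' s) ≤ (K : ℝ≥0∞) ^ d * μHE[d] (g '' s) := by
  set k : Z → Y := fun z => f (Function.invFunOn g s z) with hk
  have hmem : ∀ x ∈ s, Function.invFunOn g s (g x) ∈ s ∧ g (Function.invFunOn g s (g x)) = g x :=
    fun x hx => ⟨Function.invFunOn_mem ⟨x, hx, rfl⟩, Function.invFunOn_eq ⟨x, hx, rfl⟩⟩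
  have hkg : ∀ x ∈ s, k (g x) = f x := fun x hx => by
    have := h _ (hmem x hx).1 x hx
    rw [(hmem x hx).2, dist_self, mul_zero] at this
    exact dist_le_zero.1 this
  have hL : LipschitzOnWith K k (g '' s) := by
    refine LipschitzOnWith.of_dist_le_mul ?_
    rintro _ ⟨x, hx, rfl⟩ _ ⟨y, hy, rfl⟩
    rw [hkg x hx, hkg y hy]
    exact h x hx y hy
  have himg : k '' (g '' s) = f '' s := by
    rw [image_image]
    exact image_congr hkg
  have := hL.hausdorffMeasure_image_le (d := d) (Nat.cast_nonneg d)
  rw [himg, ENNReal.rpow_natCast] at this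
  simp only [euclideanHausdorffMeasure_def, Measure.smul_apply, nnreal_smul_coe_apply]
  rw [mul_left_comm]
  gcongr

variable {E V : Type*} [NormedAddCommGroup E] [InnerProductSpace ℝ E] [FiniteDimensional ℝ E]
  [NormedAddCommGroup V] [InnerProductSpace ℝ V]

theorem LinearMap.normDet_eq_sqrt {ι : Type*} [Fintype ι] [DecidableEq ι] (f : E →ₗ[ℝ] V)
    (b : OrthonormalBasis ι ℝ E) :
    f.normDet = √(Matrix.of fun i j => inner ℝ (f (b i)) (f (b j))).det := by
  have h := f.normDet_sq_eq_det_gram b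
  rw [← Real.sqrt_sq f.normDet_nonneg]
  exact congrArg _ h

theorem continuousOn_normDet {f : E → E →L[ℝ] V} {s : Set E} (hf : ContinuousOn f s) :
    ContinuousOn (fun x => (f x).toLinearMap.normDet) s := by
  have : ∀ x, (f x).toLinearMap.normDet =
      √(Matrix.of fun i j => inner ℝ (f x (stdOrthonormalBasis ℝ E i))
        (f x (stdOrthonormalBasis ℝ E j)) :
          Matrix (Fin (finrank ℝ E)) (Fin (finrank ℝ E)) ℝ).det :=
    fun x => LinearMap.normDet_eq_sqrt _ (stdOrthonormalBasis ℝ E)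
  simp_rw [this]
  have h : ContinuousOn (fun x => (Matrix.of fun i j => inner ℝ
      (f x (stdOrthonormalBasis ℝ E i)) (f x (stdOrthonormalBasis ℝ E j)) :
        Matrix (Fin (finrank ℝ E)) (Fin (finrank ℝ E)) ℝ)) s := by
    refine continuousOn_pi.2 fun i => continuousOn_pi.2 fun j => ?_
    exact ContinuousOn.inner (𝕜 := ℝ) (hf.clm_apply continuousOn_const)
      (hf.clm_apply continuousOn_const)
  exact Real.continuous_sqrt.comp_continuousOn (continuous_id.matrix_det.comp_continuousOn h)

theorem aemeasurable_normDet [MeasurableSpace E] [BorelSpace E] {U : Set E} (hU : IsOpen U)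
    {f : E → V} (hf : ContDiffOn ℝ 1 f U) {s : Set E} (hs : MeasurableSet s) (hsU : s ⊆ U) :
    AEMeasurable (fun x => (fderiv ℝ f x).toLinearMap.normDet.toNNReal) (volume.restrict s) :=
  (((continuousOn_normDet (hf.continuousOn_fderiv_of_isOpen hU le_rfl)).mono hsU).aemeasurable
    hs).real_toNNReal

variable [MeasurableSpace E] [BorelSpace E] [MeasurableSpace V] [BorelSpace V]

/-- Near a point where its derivative is injective, a `C¹` map changes the volume of sets by a
factor that is close to its Jacobian. -/
theorem exists_nhds_measure_image_le_lintegral {U : Set E} (hU : IsOpen U) {f : E → V}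
    (hf : ContDiffOn ℝ 1 f U) (himm : ∀ u ∈ U, Function.Injective (fderiv ℝ f u)) {u : E}
    (hu : u ∈ U) {K : ℝ≥0} (hK : 1 < K) :
    ∃ W, IsOpen W ∧ u ∈ W ∧ ∀ s ⊆ W, MeasurableSet s →
      μHE[finrank ℝ E] (f '' s) ≤ (K : ℝ≥0∞) ^ (finrank ℝ E + 1) *
        ∫⁻ x in s, ENNReal.ofReal (fderiv ℝ f x).toLinearMap.normDet ∧
      ∫⁻ x in s, ENNReal.ofReal (fderiv ℝ f x).toLinearMap.normDet ≤
        (K : ℝ≥0∞) ^ (finrank ℝ E + 1) * μHE[finrank ℝ E] (f '' s) := by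
  set A := fderiv ℝ f u with hA
  set d := finrank ℝ E with hd
  have hKr : (1 : ℝ) < K := by exact_mod_cast hK
  obtain ⟨c, hc, hcA⟩ := (LinearMap.injective_iff_antilipschitz A.toLinearMap).1 (himm u hu)
  have hcA' : ∀ x y, dist x y ≤ c * dist (A x) (A y) := fun x y => hcA.le_mul_dist x y
  -- the factor by which `f` may deviate from its linear part
  obtain ⟨ε, hε0, hε1, hε2⟩ : ∃ ε : ℝ, 0 < ε ∧ 1 + ε ≤ K ∧ 1 ≤ K * (1 - ε) := by
    -- With `ε = 1 - 1/K` the last condition is an equality, and `1 + ε ≤ K` amounts to `K + 1/K ≥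
    -- 2`.
    refine ⟨(K - 1) / K, div_pos (by linarith) (by linarith), ?_, ?_⟩
    · rw [← le_sub_iff_add_le', div_le_iff₀ (by linarith)]
      nlinarith
    · rw [mul_sub, mul_div_cancel₀ _ (by linarith)]
      linarith
  have hc0 : (0 : ℝ) < c := by exact_mod_cast hc
  have hstrict : HasStrictFDerivAt f A u :=
    (hf.contDiffAt (hU.mem_nhds hu)).hasStrictFDerivAt one_ne_zero
  -- Since `A` is antilipschitz with constant `c`, an error of `(ε/c)|x - y|` is at most `ε |A x - A
  -- y|`.
  obtain ⟨W₁, hW₁, hlin⟩ := hstrict.approximates_deriv_on_nhds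
    (c := ε.toNNReal / c) (Or.inr (div_pos (Real.toNNReal_pos.2 hε0) hc))
  have hlin' : ∀ x ∈ W₁, ∀ y ∈ W₁, ‖f x - f y - A (x - y)‖ ≤ ε * dist (A x) (A y) := by
    intro x hx y hy
    refine (hlin x hx y hy).trans ?_
    rw [NNReal.coe_div, Real.coe_toNNReal _ hε0.le, div_mul_eq_mul_div, div_le_iff₀ hc0, mul_assoc,
      mul_comm _ (c : ℝ),
      ← dist_eq_norm]
    exact mul_le_mul_of_nonneg_left (hcA' x y) hε0.le
  set J : E → ℝ := fun x => (fderiv ℝ f x).toLinearMap.normDet with hJ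
  have hJc : ContinuousOn J U := continuousOn_normDet (hf.continuousOn_fderiv_of_isOpen hU le_rfl)
  have hJu : 0 < J u :=
    lt_of_le_of_ne (LinearMap.normDet_nonneg _)
      (Ne.symm (((LinearMap.normDet_ne_zero_tfae A.toLinearMap).out 0 4).2 (himm u hu)))
  have hJ1 : ∀ᶠ x in 𝓝 u, J x < K * J u :=
    (hJc.continuousAt (hU.mem_nhds hu)).eventually_lt_const (by nlinarith)
  have hJ2 : ∀ᶠ x in 𝓝 u, J u < K * J x := by
    have h : J u < K * J u := by nlinarith
    exact (continuousAt_const.mul (hJc.continuousAt (hU.mem_nhds hu))).eventually_const_lt h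
  obtain ⟨W, hWsub, hWo, huW⟩ := mem_nhds_iff.1 (inter_mem hW₁ (hJ1.and hJ2))
  refine ⟨W, hWo, huW, fun s hs hsm => ?_⟩
  -- Distances under `f` and under `A` agree up to a factor `K`, which costs `K ^ d` in measure. The
  -- remaining factor of `K ^ (d + 1)` pays for the variation of the Jacobian on `W`.
  have h1 : μHE[d] (f '' s) ≤ (K : ℝ≥0∞) ^ d * μHE[d] (A.toLinearMap '' s) := by
    refine hausdorffMeasure_image_le_of_dist_le (fun x hx y hy => ?_) d
    have := hlin' x (hWsub (hs hx)).1 y (hWsub (hs hy)).1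
    have h2 := norm_sub_norm_le (f x - f y) (A (x - y))
    rw [map_sub, ← dist_eq_norm, ← dist_eq_norm] at h2
    rw [map_sub] at this
    change _ ≤ K * dist (A x) (A y)
    nlinarith [dist_nonneg (x := A x) (y := A y)]
  have h2 : μHE[d] (A.toLinearMap '' s) ≤ (K : ℝ≥0∞) ^ d * μHE[d] (f '' s) := by
    refine hausdorffMeasure_image_le_of_dist_le (fun x hx y hy => ?_) d
    have := hlin' x (hWsub (hs hx)).1 y (hWsub (hs hy)).1
    have h2 := norm_sub_norm_le (A (x - y)) (f x - f y)
    rw [norm_sub_rev (A (x - y)), map_sub, ← dist_eq_norm, ← dist_eq_norm] at h2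
    rw [map_sub] at this
    change dist (A x) (A y) ≤ _
    have h3 : (1 - ε) * dist (A x) (A y) ≤ dist (f x) (f y) := by linarith
    have h4 := mul_le_mul_of_nonneg_left h3 (zero_le_one.trans hKr.le)
    nlinarith [dist_nonneg (x := A x) (y := A y)]
  rw [LinearMap.euclideanHausdorffMeasure_image_eq_normDet_mul_volume] at h1 h2
  have h3 : ENNReal.ofReal (J u) * volume s ≤ K * ∫⁻ x in s, ENNReal.ofReal (J x) := by
    rw [← setLIntegral_const, ← lintegral_const_mul' _ _ ENNReal.coe_ne_top]
    refine setLIntegral_mono' hsm fun x hx => ?_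
    rw [← ENNReal.ofReal_coe_nnreal, ← ENNReal.ofReal_mul K.coe_nonneg]
    exact ENNReal.ofReal_le_ofReal (hWsub (hs hx)).2.2.le
  have h4 : ∫⁻ x in s, ENNReal.ofReal (J x) ≤ K * (ENNReal.ofReal (J u) * volume s) := by
    rw [← mul_assoc, ← setLIntegral_const]
    refine setLIntegral_mono' hsm fun x hx => ?_
    rw [← ENNReal.ofReal_coe_nnreal, ← ENNReal.ofReal_mul K.coe_nonneg]
    exact ENNReal.ofReal_le_ofReal (hWsub (hs hx)).2.1.le
  constructor
  · refine h1.trans ?_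
    rw [pow_succ, mul_assoc]
    gcongr
  · refine h4.trans ?_
    rw [pow_succ', mul_assoc]
    gcongr

/-- The area formula for injective immersions of class `C¹`. -/
theorem euclideanHausdorffMeasure_image_eq_lintegral_normDet {U : Set E} (hU : IsOpen U)
    {f : E → V} (hf : ContDiffOn ℝ 1 f U) (himm : ∀ u ∈ U, Function.Injective (fderiv ℝ f u))
    (hinj : InjOn f U) {s : Set E} (hs : MeasurableSet s) (hsU : s ⊆ U) :
    μHE[finrank ℝ E] (f '' s) =
      ∫⁻ x in s, ENNReal.ofReal (fderiv ℝ f x).toLinearMap.normDet := by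
  have key : ∀ K : ℝ≥0, 1 < K →
      μHE[finrank ℝ E] (f '' s) ≤ (K : ℝ≥0∞) ^ (finrank ℝ E + 1) *
        ∫⁻ x in s, ENNReal.ofReal (fderiv ℝ f x).toLinearMap.normDet ∧
      ∫⁻ x in s, ENNReal.ofReal (fderiv ℝ f x).toLinearMap.normDet ≤
        (K : ℝ≥0∞) ^ (finrank ℝ E + 1) * μHE[finrank ℝ E] (f '' s) := by
    intro K hK
    choose! W hWo hWu hW using fun u (hu : u ∈ U) =>
      exists_nhds_measure_image_le_lintegral hU hf himm hu hK
    obtain ⟨t, htU, htc, hcov⟩ := TopologicalSpace.countable_cover_nhdsWithin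
      (f := W) (s := U) fun u hu => mem_nhdsWithin_of_mem_nhds ((hWo u hu).mem_nhds (hWu u hu))
    rcases t.eq_empty_or_nonempty with rfl | htne
    · have : s = ∅ := subset_empty_iff.1 (hsU.trans (by simpa using hcov))
      simp [this]
    obtain ⟨e, rfl⟩ := htc.exists_eq_range htne
    have heU : ∀ n, e n ∈ U := fun n => htU (mem_range_self n)
    -- Disjoint pieces of `s`, each inside one good neighbourhood. Injectivity keeps their images
    -- disjoint, so both sides are countably additive over the pieces.
    set D : ℕ → Set E := fun n => s ∩ disjointed (fun n => W (e n)) n with hD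
    have hDm : ∀ n, MeasurableSet (D n) := fun n =>
      hs.inter (MeasurableSet.disjointed (fun i => (hWo _ (heU i)).measurableSet) n)
    have hDW : ∀ n, D n ⊆ W (e n) := fun n =>
      inter_subset_right.trans (disjointed_subset _ n)
    have hDd : Pairwise (Function.onFun Disjoint D) :=
      pairwise_disjoint_mono (disjoint_disjointed _) fun n => inter_subset_right
    have hDs : s = ⋃ n, D n := by
      rw [hD, ← inter_iUnion, iUnion_disjointed, eq_comm, inter_eq_left]
      refine hsU.trans (hcov.trans ?_)
      simp
    have hDU : ∀ n, D n ⊆ U := fun n => inter_subset_left.trans hsU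
    have e1 : μHE[finrank ℝ E] (f '' s) = ∑' n, μHE[finrank ℝ E] (f '' D n) := by
      conv_lhs => rw [hDs, image_iUnion]
      refine measure_iUnion (fun i j hij => ?_) fun n => ?_
      · exact (hDd hij).image hinj (hDU i) (hDU j)
      · exact (hDm n).image_of_continuousOn_injOn (hf.continuousOn.mono (hDU n))
          (hinj.mono (hDU n))
    have e2 : ∫⁻ x in s, ENNReal.ofReal (fderiv ℝ f x).toLinearMap.normDet =
        ∑' n, ∫⁻ x in D n, ENNReal.ofReal (fderiv ℝ f x).toLinearMap.normDet := by
      conv_lhs => rw [hDs]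
      exact lintegral_iUnion hDm hDd _
    rw [e1, e2, ← ENNReal.tsum_mul_left, ← ENNReal.tsum_mul_left]
    exact ⟨ENNReal.tsum_le_tsum fun n => (hW _ (heU n) _ (hDW n) (hDm n)).1,
      ENNReal.tsum_le_tsum fun n => (hW _ (heU n) _ (hDW n) (hDm n)).2⟩
  -- The two-sided estimate holds for every `K > 1`; letting `K` decrease to `1` gives equality.
  have lim : ∀ a b : ℝ≥0∞, (∀ K : ℝ≥0, 1 < K → a ≤ (K : ℝ≥0∞) ^ (finrank ℝ E + 1) * b) →
      a ≤ b := by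
    intro a b h
    have ht : Tendsto (fun K : ℝ≥0 => (K : ℝ≥0∞) ^ (finrank ℝ E + 1) * b) (𝓝[>] 1)
        (𝓝 (((1 : ℝ≥0) : ℝ≥0∞) ^ (finrank ℝ E + 1) * b)) := by
      refine Tendsto.mono_left ?_ nhdsWithin_le_nhds
      refine ENNReal.Tendsto.mul_const ?_ (Or.inl (by simp))
      exact ENNReal.Tendsto.pow (ENNReal.tendsto_coe.2 tendsto_id)
    rw [ENNReal.coe_one, one_pow, one_mul] at ht
    exact ge_of_tendsto ht (eventually_nhdsWithin_of_forall fun K hK => h K hK)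
  exact le_antisymm (lim _ _ fun K hK => (key K hK).1) (lim _ _ fun K hK => (key K hK).2)

variable {F : Type*} [NormedAddCommGroup F] [NormedSpace ℝ F]

/-- As an identity of measures, the area formula transports integrability and integrals alike, for
integrands with values in any normed space. -/
theorem map_withDensity_normDet {U : Set E} (hU : IsOpen U)
    {f : E → V} (hf : ContDiffOn ℝ 1 f U) (himm : ∀ u ∈ U, Function.Injective (fderiv ℝ f u))
    (hinj : InjOn f U) {s : Set E} (hs : MeasurableSet s) (hsU : s ⊆ U) :
    Measure.map (s.domRestrict f) (comap (↑) (volume.withDensity fun x =>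
      ENNReal.ofReal (fderiv ℝ f x).toLinearMap.normDet)) =
      μHE[finrank ℝ E].restrict (f '' s) := by
  have hfm : Measurable (s.domRestrict f) :=
    (continuousOn_iff_continuous_domRestrict.1 (hf.continuousOn.mono hsU)).measurable
  refine Measure.ext fun t ht => ?_
  have hm : MeasurableSet (s ∩ f ⁻¹' t) := by
    have := (MeasurableEmbedding.subtype_coe hs).measurableSet_image.2 (hfm ht)
    convert! this using 1
    ext x
    simp [and_comm]
  have himg : (Subtype.val '' (s.domRestrict f ⁻¹' t)) = s ∩ f ⁻¹' t := by
    ext x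
    simp [and_comm]
  rw [Measure.map_apply hfm ht, comap_apply _ Subtype.val_injective
    (fun t => (MeasurableEmbedding.subtype_coe hs).measurableSet_image.2) _ (hfm ht), himg,
    withDensity_apply _ hm, restrict_apply ht,
    ← euclideanHausdorffMeasure_image_eq_lintegral_normDet hU hf himm hinj hm
      (inter_subset_left.trans hsU), image_inter_preimage, inter_comm]

/-- Integrability in the area formula for injective immersions. -/
theorem integrableOn_image_iff_integrableOn_normDet_smul {U : Set E} (hU : IsOpen U)
    {f : E → V} (hf : ContDiffOn ℝ 1 f U) (himm : ∀ u ∈ U, Function.Injective (fderiv ℝ f u))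
    (hinj : InjOn f U) {s : Set E} (hs : MeasurableSet s) (hsU : s ⊆ U) (g : V → F) :
    IntegrableOn g (f '' s) μHE[finrank ℝ E] ↔
      IntegrableOn (fun x => (fderiv ℝ f x).toLinearMap.normDet • g (f x)) s := by
  rw [IntegrableOn, ← map_withDensity_normDet hU hf himm hinj hs hsU,
    ((hf.continuousOn.mono hsU).measurableEmbedding hs (hinj.mono hsU)).integrable_map_iff]
  simp only [Set.domRestrict_eq, ← Function.comp_assoc, ENNReal.ofReal]
  rw [← (MeasurableEmbedding.subtype_coe hs).integrable_map_iff, map_comap_subtype_coe hs,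
    restrict_withDensity hs, integrable_withDensity_iff_integrable_coe_smul₀]
  · simp_rw [IntegrableOn, Real.coe_toNNReal _ (LinearMap.normDet_nonneg _), Function.comp_apply]
  · exact aemeasurable_normDet hU hf hs hsU

/-- Change of variables in the area formula for injective immersions. -/
theorem integral_image_eq_integral_normDet_smul {U : Set E} (hU : IsOpen U)
    {f : E → V} (hf : ContDiffOn ℝ 1 f U) (himm : ∀ u ∈ U, Function.Injective (fderiv ℝ f u))
    (hinj : InjOn f U) {s : Set E} (hs : MeasurableSet s) (hsU : s ⊆ U) (g : V → F) :
    ∫ y in f '' s, g y ∂μHE[finrank ℝ E] =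
      ∫ x in s, (fderiv ℝ f x).toLinearMap.normDet • g (f x) := by
  rw [← map_withDensity_normDet hU hf himm hinj hs hsU,
    ((hf.continuousOn.mono hsU).measurableEmbedding hs (hinj.mono hsU)).integral_map]
  simp only [Set.domRestrict_apply, ← Function.comp_apply (f := g), ENNReal.ofReal]
  rw [← (MeasurableEmbedding.subtype_coe hs).integral_map, map_comap_subtype_coe hs,
    setIntegral_withDensity_eq_setIntegral_smul₀ (aemeasurable_normDet hU hf hs hsU) _ hs]
  congr with x
  rw [NNReal.smul_def, Real.coe_toNNReal _ (LinearMap.normDet_nonneg _)]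

end AreaFormula

/-! ### The divergence theorem on a half plane -/

section HalfPlane

theorem measurePreserving_planeMk :
    MeasurePreserving (fun z : ℝ × ℝ => (!₂[z.1, z.2] : Plane)) :=
  (PiLp.volume_preserving_toLp (Fin 2)).comp (volume_preserving_finTwoArrow ℝ).symm

theorem continuous_planeMk : Continuous (fun z : ℝ × ℝ => (!₂[z.1, z.2] : Plane)) := by
  fun_prop

theorem isClosedEmbedding_planeMk :
    Topology.IsClosedEmbedding (fun z : ℝ × ℝ => (!₂[z.1, z.2] : Plane)) := by
  refine Function.LeftInverse.isClosedEmbedding (f := fun u : Plane => (u 0, u 1)) ?_ ?_ ?_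
  · intro z
    simp
  · fun_prop
  · exact continuous_planeMk

theorem HasCompactSupport.comp_planeMk {F : Type*} [NormedAddCommGroup F] {g : Plane → F}
    (hg : HasCompactSupport g) :
    HasCompactSupport (fun z : ℝ × ℝ => g !₂[z.1, z.2]) :=
  HasCompactSupport.comp_isClosedEmbedding hg isClosedEmbedding_planeMk

variable {F : Type*} [NormedAddCommGroup F] [NormedSpace ℝ F]

theorem setIntegral_halfPlane_eq_setIntegral_prod (g : Plane → F) :
    ∫ u in {u : Plane | u 0 ≤ 0}, g u = ∫ z in Iic (0 : ℝ) ×ˢ (univ : Set ℝ), g !₂[z.1, z.2] := by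
  rw [← measurePreserving_planeMk.setIntegral_preimage_emb
    isClosedEmbedding_planeMk.measurableEmbedding]
  congr 2
  ext z
  simp

theorem planeMk_eq (s t : ℝ) : (!₂[s, t] : Plane) =
    s • EuclideanSpace.single 0 1 + t • EuclideanSpace.single 1 1 := by
  ext i
  fin_cases i <;> simp

theorem hasDerivAt_planeMk_left (s t : ℝ) :
    HasDerivAt (fun s => (!₂[s, t] : Plane)) (EuclideanSpace.single 0 1) s := by
  simp_rw [planeMk_eq]
  simpa using ((hasDerivAt_id s).smul_const (EuclideanSpace.single 0 1 : Plane)).add_const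
    (t • EuclideanSpace.single 1 1 : Plane)

theorem hasDerivAt_planeMk_right (s t : ℝ) :
    HasDerivAt (fun t => (!₂[s, t] : Plane)) (EuclideanSpace.single 1 1) t := by
  simp_rw [planeMk_eq]
  simpa using ((hasDerivAt_id t).smul_const (EuclideanSpace.single 1 1 : Plane)).const_add
    (s • EuclideanSpace.single 0 1 : Plane)

theorem contDiff_planeMk {n : ℕ∞ω} : ContDiff ℝ n (fun z : ℝ × ℝ => (!₂[z.1, z.2] : Plane)) := by
  simp_rw [planeMk_eq]
  fun_prop

theorem isClosedEmbedding_planeMk_left (t : ℝ) :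
    Topology.IsClosedEmbedding (fun s : ℝ => (!₂[s, t] : Plane)) := by
  refine Function.LeftInverse.isClosedEmbedding (f := fun u : Plane => u 0) ?_ ?_ ?_
  · intro z
    simp
  · fun_prop
  · fun_prop

theorem isClosedEmbedding_planeMk_right (s : ℝ) :
    Topology.IsClosedEmbedding (fun t : ℝ => (!₂[s, t] : Plane)) := by
  refine Function.LeftInverse.isClosedEmbedding (f := fun u : Plane => u 1) ?_ ?_ ?_
  · intro z
    simp
  · fun_prop
  · fun_prop

variable {X : Plane → F}

theorem continuous_fderiv_single (hX : ContDiff ℝ 1 X) (i : Fin 2) :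
    Continuous fun u => fderiv ℝ X u (EuclideanSpace.single i 1) :=
  (hX.continuous_fderiv one_ne_zero).clm_apply continuous_const

theorem hasCompactSupport_fderiv_single (hXc : HasCompactSupport X) (i : Fin 2) :
    HasCompactSupport fun u => fderiv ℝ X u (EuclideanSpace.single i 1) :=
  hXc.fderiv_apply ℝ _

theorem integrable_fderiv_planeMk (hX : ContDiff ℝ 1 X) (hXc : HasCompactSupport X) (i : Fin 2) :
    Integrable fun z : ℝ × ℝ => fderiv ℝ X !₂[z.1, z.2] (EuclideanSpace.single i 1) :=
  ((continuous_fderiv_single hX i).comp continuous_planeMk).integrable_of_hasCompactSupport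
    (hasCompactSupport_fderiv_single hXc i).comp_planeMk

/-- By Fubini, integrate first along the normal direction: compact support kills the end at `-∞`,
and the value at `u⁰ = 0` remains. -/
theorem integral_halfPlane_fderiv_zero [CompleteSpace F] (hX : ContDiff ℝ 1 X)
    (hXc : HasCompactSupport X) :
    ∫ u in {u : Plane | u 0 ≤ 0}, fderiv ℝ X u (EuclideanSpace.single 0 1) =
      ∫ t : ℝ, X !₂[0, t] := by
  rw [setIntegral_halfPlane_eq_setIntegral_prod, Measure.volume_eq_prod, ← Measure.prod_restrict,
    Measure.restrict_univ, integral_prod_symm]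
  · congr 1
    ext t
    have hd : ∀ s : ℝ, HasDerivAt (fun s => X !₂[s, t])
        (fderiv ℝ X !₂[s, t] (EuclideanSpace.single 0 1)) s := fun s =>
      ((hX.differentiable one_ne_zero _).hasFDerivAt).comp_hasDerivAt s
        (hasDerivAt_planeMk_left s t)
    have h1 : ContDiff ℝ 1 (fun s => X !₂[s, t]) :=
      hX.comp (contDiff_planeMk.comp (contDiff_prodMk_left t))
    have h2 : HasCompactSupport (fun s => X !₂[s, t]) :=
      hXc.comp_isClosedEmbedding (isClosedEmbedding_planeMk_left t)
    rw [← h2.integral_Iic_deriv_eq h1 0]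
    simp_rw [(hd _).deriv]
  · have := (integrable_fderiv_planeMk hX hXc 0).integrableOn (s := Iic (0 : ℝ) ×ˢ (univ : Set ℝ))
    rwa [IntegrableOn, Measure.volume_eq_prod, ← Measure.prod_restrict,
      Measure.restrict_univ] at this

/-- The lines parallel to the boundary are complete, so compact support leaves no boundary term. -/
theorem integral_halfPlane_fderiv_one [CompleteSpace F] (hX : ContDiff ℝ 1 X)
    (hXc : HasCompactSupport X) :
    ∫ u in {u : Plane | u 0 ≤ 0}, fderiv ℝ X u (EuclideanSpace.single 1 1) = 0 := by
  rw [setIntegral_halfPlane_eq_setIntegral_prod, Measure.volume_eq_prod, ← Measure.prod_restrict,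
    Measure.restrict_univ, integral_prod]
  · refine integral_eq_zero_of_ae (Filter.Eventually.of_forall fun s => ?_)
    have hd : ∀ t : ℝ, HasDerivAt (fun t => X !₂[s, t])
        (fderiv ℝ X !₂[s, t] (EuclideanSpace.single 1 1)) t := fun t =>
      ((hX.differentiable one_ne_zero _).hasFDerivAt).comp_hasDerivAt t
        (hasDerivAt_planeMk_right s t)
    have h1 : ContDiff ℝ 1 (fun t => X !₂[s, t]) :=
      hX.comp (contDiff_planeMk.comp (contDiff_prodMk_right s))
    have h2 : HasCompactSupport (fun t => X !₂[s, t]) :=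
      hXc.comp_isClosedEmbedding (isClosedEmbedding_planeMk_right s)
    have h3 := integral_of_hasDerivAt_of_tendsto hd
      (((continuous_fderiv_single hX 1).comp (by fun_prop)).integrable_of_hasCompactSupport
        ((hasCompactSupport_fderiv_single hXc 1).comp_isClosedEmbedding
          (isClosedEmbedding_planeMk_right s)))
      (h2.is_zero_at_infty.mono_left atBot_le_cocompact)
      (h2.is_zero_at_infty.mono_left atTop_le_cocompact)
    simpa using h3
  · have := (integrable_fderiv_planeMk hX hXc 1).integrableOn (s := Iic (0 : ℝ) ×ˢ (univ : Set ℝ))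
    rwa [IntegrableOn, Measure.volume_eq_prod, ← Measure.prod_restrict,
      Measure.restrict_univ] at this

/-- The divergence theorem on the half plane `u⁰ ≤ 0`, for compactly supported fields. -/
theorem integral_halfPlane_divergence [CompleteSpace F] {Y : Plane → F} (hX : ContDiff ℝ 1 X)
    (hXc : HasCompactSupport X) (hY : ContDiff ℝ 1 Y) (hYc : HasCompactSupport Y) :
    ∫ u in {u : Plane | u 0 ≤ 0}, (fderiv ℝ X u (EuclideanSpace.single 0 1) +
      fderiv ℝ Y u (EuclideanSpace.single 1 1)) = ∫ t : ℝ, X !₂[0, t] := by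
  rw [integral_add, integral_halfPlane_fderiv_zero hX hXc, integral_halfPlane_fderiv_one hY hYc,
    add_zero]
  · exact ((continuous_fderiv_single hX 0).integrable_of_hasCompactSupport
      (hasCompactSupport_fderiv_single hXc 0)).integrableOn
  · exact ((continuous_fderiv_single hY 1).integrable_of_hasCompactSupport
      (hasCompactSupport_fderiv_single hYc 1)).integrableOn

end HalfPlane

/-! ### Changes of parameters, and independence of the chart -/

section Transition

open Filter
open scoped Topology

namespace SurfaceChart

variable {S : Set Space} (φ ψ : SurfaceChart S)

theorem injOn : InjOn φ.toFun φ.source :=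
  injOn_iff_injective.2 φ.embedding.injective

variable {φ ψ}

theorem contDiffAt {u : Plane} (hu : u ∈ φ.source) : ContDiffAt ℝ ∞ φ.toFun u :=
  φ.smooth.contDiffAt (φ.isOpen_source.mem_nhds hu)

theorem hasFDerivAt {u : Plane} (hu : u ∈ φ.source) :
    HasFDerivAt φ.toFun (fderiv ℝ φ.toFun u) u :=
  ((contDiffAt hu).differentiableAt (by simp)).hasFDerivAt

theorem toFun_mem {u : Plane} (hu : u ∈ φ.source) : φ.toFun u ∈ S := by
  obtain ⟨W, -, hW⟩ := φ.image_open
  exact (hW.subset (mem_image_of_mem _ hu)).1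

/-- A chart is open as a map into `S`: it is a homeomorphism onto its image, and that image is
relatively open. -/
theorem image_mem_nhdsWithin {u : Plane} (hu : u ∈ φ.source) {N : Set Plane} (hN : N ∈ 𝓝 u) :
    φ.toFun '' (φ.source ∩ N) ∈ 𝓝[S] (φ.toFun u) := by
  obtain ⟨W, hWo, hW⟩ := φ.image_open
  have hN' : (Subtype.val ⁻¹' N : Set φ.source) ∈ 𝓝 (⟨u, hu⟩ : φ.source) :=
    continuous_subtype_val.continuousAt.preimage_mem_nhds hN
  rw [φ.embedding.nhds_eq_comap, mem_comap] at hN'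
  obtain ⟨O, hO, hON⟩ := hN'
  have hu' : φ.toFun u ∈ W := (hW.subset (mem_image_of_mem _ hu)).2
  filter_upwards [mem_nhdsWithin_of_mem_nhds hO, mem_nhdsWithin_of_mem_nhds (hWo.mem_nhds hu'),
    self_mem_nhdsWithin] with p hpO hpW hpS
  obtain ⟨y, hy, rfl⟩ := hW.superset ⟨hpS, hpW⟩
  have hyN : (⟨y, hy⟩ : φ.source) ∈ (Subtype.val ⁻¹' N : Set φ.source) := hON hpO
  exact ⟨y, ⟨hy, hyN⟩, rfl⟩

/-- Charts around the same point are related by a smooth change of parameters. -/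
theorem exists_transition {u v : Plane} (hu : u ∈ φ.source) (hv : v ∈ ψ.source)
    (huv : φ.toFun u = ψ.toFun v) :
    ∃ τ : Plane → Plane, ContDiffAt ℝ 2 τ u ∧ τ u = v ∧
      ∀ᶠ x in 𝓝 u, x ∈ φ.source ∧ τ x ∈ ψ.source ∧ ψ.toFun (τ x) = φ.toFun x := by
  set A := fderiv ℝ ψ.toFun v with hA
  -- Composing with the adjoint turns `ψ` into a map of the plane whose derivative `AᵀA` at `v` is
  -- invertible because `A` is injective. The inverse function theorem then yields `τ = (Aᵀψ)⁻¹ ∘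
  -- Aᵀφ`.
  set L : Space →L[ℝ] Plane := A.adjoint with hL
  have hinj : Function.Injective (L ∘L A) := by
    rw [injective_iff_map_eq_zero]
    intro w hw
    have h : ‖A w‖ ^ 2 = 0 := by
      rw [← real_inner_self_eq_norm_sq, ← ContinuousLinearMap.adjoint_inner_right]
      have : A.adjoint (A w) = 0 := hw
      rw [this, inner_zero_right]
    exact (injective_iff_map_eq_zero A).1 (ψ.immersion v hv) w (by simpa using h)
  set e : Plane ≃L[ℝ] Plane :=
    (LinearEquiv.ofInjectiveEndo (L ∘L A).toLinearMap hinj).toContinuousLinearEquiv with he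
  have hk : ContDiffAt ℝ ∞ (fun x => L (ψ.toFun x)) v := L.contDiff.contDiffAt.comp v (contDiffAt hv)
  have hk' : HasFDerivAt (fun x => L (ψ.toFun x)) (e : Plane →L[ℝ] Plane) v := by
    convert! L.hasFDerivAt.comp v (hasFDerivAt hv) using 1
  have hn : (∞ : ℕ∞ω) ≠ 0 := by simp
  have hleft := (hk.hasStrictFDerivAt' hk' hn).eventually_left_inverse
  set τ : Plane → Plane := fun x => hk.localInverse hk' hn (L (φ.toFun x)) with hτ
  have hev : ∀ᶠ x in 𝓝 u, x ∈ φ.source ∧ τ x ∈ ψ.source ∧ ψ.toFun (τ x) = φ.toFun x := by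
    -- Equality after applying `Aᵀ` would not suffice. Here `φ x` lies in `S` near `ψ v`, hence is
    -- some `ψ y` with `y` in the region where the local inverse recovers `y`.
    have h1 := image_mem_nhdsWithin hv hleft
    rw [← huv] at h1
    have h2 : Tendsto φ.toFun (𝓝 u) (𝓝[S] φ.toFun u) := by
      refine tendsto_nhdsWithin_of_tendsto_nhds_of_eventually_within _
        (contDiffAt hu).continuousAt ?_
      filter_upwards [φ.isOpen_source.mem_nhds hu] with x hx using toFun_mem hx
    filter_upwards [h2 h1, φ.isOpen_source.mem_nhds hu] with x ⟨y, ⟨hys, hyN⟩, hyx⟩ hx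
    have : τ x = y := by
      simp only [hτ, ← hyx]
      exact hyN
    rw [this]
    exact ⟨hx, hys, hyx⟩
  refine ⟨τ, ?_, ?_, hev⟩
  · refine ContDiffAt.of_le (n := ∞) ?_ (ENat.LEInfty.out : (2 : ℕ∞ω) ≤ ∞)
    refine ContDiffAt.comp u ?_ (L.contDiff.contDiffAt.comp u (contDiffAt hu))
    have := hk.to_localInverse hk' hn
    rwa [← huv] at this
  · have := hev.self_of_nhds
    exact ψ.injOn this.2.1 hv (this.2.2.trans huv)

section TransitionMap

variable {u v : Plane} {τ : Plane → Plane}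

theorem fderiv_eq_comp_transition (hτ : ContDiffAt ℝ 2 τ u)
    (hev : ∀ᶠ x in 𝓝 u, x ∈ φ.source ∧ τ x ∈ ψ.source ∧ ψ.toFun (τ x) = φ.toFun x) :
    fderiv ℝ φ.toFun u = fderiv ℝ ψ.toFun (τ u) ∘L fderiv ℝ τ u := by
  have h1 : (fun x => ψ.toFun (τ x)) =ᶠ[𝓝 u] φ.toFun := hev.mono fun x hx => hx.2.2
  rw [← h1.fderiv_eq]
  exact ((hasFDerivAt hev.self_of_nhds.2.1).comp u
    (hτ.differentiableAt (by simp)).hasFDerivAt).fderiv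

theorem plane_eq_sum (w : Plane) : w = ∑ α, w α • EuclideanSpace.single α (1 : ℝ) := by
  ext i
  fin_cases i <;> simp

theorem fderiv_eq_sum_basis (u w : Plane) :
    fderiv ℝ φ.toFun u w = ∑ α, w α • φ.basis α u := by
  conv_lhs => rw [plane_eq_sum w]
  simp [basis]

theorem basis_eq_sum_transition (hτ : ContDiffAt ℝ 2 τ u)
    (hev : ∀ᶠ x in 𝓝 u, x ∈ φ.source ∧ τ x ∈ ψ.source ∧ ψ.toFun (τ x) = φ.toFun x) (α : Fin 2) :
    φ.basis α u = ∑ γ, (fderiv ℝ τ u (EuclideanSpace.single α 1)) γ • ψ.basis γ (τ u) := by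
  rw [basis, fderiv_eq_comp_transition hτ hev, ContinuousLinearMap.comp_apply,
    fderiv_eq_sum_basis]

theorem contDiffOn_basis (α : Fin 2) : ContDiffOn ℝ ∞ (φ.basis α) φ.source :=
  (φ.smooth.fderiv_of_isOpen φ.isOpen_source (by simp)).clm_apply contDiffOn_const

theorem hasFDerivAt_basis (hu : u ∈ φ.source) (α : Fin 2) :
    HasFDerivAt (φ.basis α) (fderiv ℝ (φ.basis α) u) u :=
  ((((contDiffOn_basis α).contDiffAt (φ.isOpen_source.mem_nhds hu))).differentiableAt
    (by simp)).hasFDerivAt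

/-- The Jacobian matrix of a change of parameters. -/
noncomputable def transitionMatrix (τ : Plane → Plane) (u : Plane) : Matrix (Fin 2) (Fin 2) ℝ :=
  Matrix.of fun γ α => fderiv ℝ τ u (EuclideanSpace.single α 1) γ

theorem metric_eq_transition (hτ : ContDiffAt ℝ 2 τ u)
    (hev : ∀ᶠ x in 𝓝 u, x ∈ φ.source ∧ τ x ∈ ψ.source ∧ ψ.toFun (τ x) = φ.toFun x) :
    φ.metric u =
      (transitionMatrix τ u).transpose * ψ.metric (τ u) * transitionMatrix τ u := by
  ext α β
  rw [metric, Matrix.of_apply, basis_eq_sum_transition hτ hev, basis_eq_sum_transition hτ hev]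
  simp only [Matrix.mul_apply, Matrix.transpose_apply, transitionMatrix, Matrix.of_apply,
    Fin.sum_univ_two, inner_add_left, inner_add_right, real_inner_smul_left,
    real_inner_smul_right, metric]
  ring

/-- Differentiating the transformed basis produces a term with second derivatives of `τ`, but that
term is a combination of the `ψ.basis γ` and `ν` annihilates it. Thus `B` transforms as a tensor. -/
theorem curvature_eq_transition (hτ : ContDiffAt ℝ 2 τ u)
    (hev : ∀ᶠ x in 𝓝 u, x ∈ φ.source ∧ τ x ∈ ψ.source ∧ ψ.toFun (τ x) = φ.toFun x)
    {ν : Space} (hν : ∀ γ, inner ℝ ν (ψ.basis γ (τ u)) = 0) :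
    φ.curvature ν u =
      (transitionMatrix τ u).transpose * ψ.curvature ν (τ u) * transitionMatrix τ u := by
  ext α β
  have hev' : ∀ᶠ x in 𝓝 u, φ.basis α x =
      ∑ γ, (fderiv ℝ τ x (EuclideanSpace.single α 1)) γ • ψ.basis γ (τ x) := by
    filter_upwards [hev.eventually_nhds, hτ.eventually (by simp)] with x hx hx'
    exact basis_eq_sum_transition hx' hx α
  have hτd : HasFDerivAt τ (fderiv ℝ τ u) u := (hτ.differentiableAt (by simp)).hasFDerivAt
  have hc : ∀ γ : Fin 2, DifferentiableAt ℝ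
      (fun x => (fderiv ℝ τ x (EuclideanSpace.single α 1)) γ) u := by
    intro γ
    have h1 : DifferentiableAt ℝ (fderiv ℝ τ) u :=
      (hτ.fderiv_right (m := 1) (by norm_num [one_add_one_eq_two])).differentiableAt (by simp)
    exact differentiableAt_euclidean.1 (h1.clm_apply (differentiableAt_const _)) γ
  have hb : ∀ γ : Fin 2, HasFDerivAt (fun x => ψ.basis γ (τ x))
      (fderiv ℝ (ψ.basis γ) (τ u) ∘L fderiv ℝ τ u) u := fun γ =>
    (hasFDerivAt_basis hev.self_of_nhds.2.1 γ).comp u hτd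
  have hsum := HasFDerivAt.fun_sum (u := Finset.univ)
    fun (γ : Fin 2) _ => ((hc γ).hasFDerivAt).smul (hb γ)
  have hd := (EventuallyEq.fderiv_eq hev').trans hsum.fderiv
  have hw := plane_eq_sum (fderiv ℝ τ u (EuclideanSpace.single β 1))
  rw [curvature, Matrix.of_apply, hd]
  simp only [sum_apply, add_apply,
    smul_apply, ContinuousLinearMap.comp_apply,
    ContinuousLinearMap.smulRight_apply]
  rw [hw]
  simp only [Matrix.mul_apply, Matrix.transpose_apply, transitionMatrix, Matrix.of_apply,
    Fin.sum_univ_two, inner_add_right, map_add, map_smul, real_inner_smul_right, curvature, hν]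
  ring

theorem injective_fderiv_transition (hτ : ContDiffAt ℝ 2 τ u)
    (hev : ∀ᶠ x in 𝓝 u, x ∈ φ.source ∧ τ x ∈ ψ.source ∧ ψ.toFun (τ x) = φ.toFun x) :
    Function.Injective (fderiv ℝ τ u) := by
  have h := φ.immersion u hev.self_of_nhds.1
  rw [fderiv_eq_comp_transition hτ hev, ContinuousLinearMap.coe_comp] at h
  exact h.of_comp

theorem isUnit_transitionMatrix (hτ : ContDiffAt ℝ 2 τ u)
    (hev : ∀ᶠ x in 𝓝 u, x ∈ φ.source ∧ τ x ∈ ψ.source ∧ ψ.toFun (τ x) = φ.toFun x) :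
    IsUnit (transitionMatrix τ u) := by
  rw [← Matrix.mulVec_injective_iff_isUnit]
  have key : ∀ w : Fin 2 → ℝ, (transitionMatrix τ u).mulVec w =
      WithLp.ofLp (fderiv ℝ τ u (WithLp.toLp 2 w)) := by
    intro w
    ext γ
    conv_rhs => rw [plane_eq_sum (WithLp.toLp 2 w)]
    simp [Matrix.mulVec, dotProduct, transitionMatrix, mul_comm]
  intro w w' h
  rw [key, key] at h
  exact WithLp.toLp_injective 2 (injective_fderiv_transition hτ hev (WithLp.ofLp_injective 2 h))

end TransitionMap

theorem traceCurvature_eq_trace (ν : Space) (u : Plane) :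
    φ.traceCurvature ν u = ((φ.metric u)⁻¹ * (φ.curvature ν u).transpose).trace := by
  simp [traceCurvature, Matrix.trace, Matrix.mul_apply]

/-- The mean curvature does not depend on the chart. -/
theorem traceCurvature_eq_of_toFun_eq {u v : Plane} (hu : u ∈ φ.source) (hv : v ∈ ψ.source)
    (huv : φ.toFun u = ψ.toFun v) {ν : Space} (hν : ∀ γ, inner ℝ ν (ψ.basis γ v) = 0) :
    φ.traceCurvature ν u = ψ.traceCurvature ν v := by
  obtain ⟨τ, hτ, rfl, hev⟩ := exists_transition hu hv huv
  have hT := isUnit_transitionMatrix hτ hev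
  rw [Matrix.isUnit_iff_isUnit_det] at hT
  rw [traceCurvature_eq_trace, traceCurvature_eq_trace, metric_eq_transition hτ hev,
    curvature_eq_transition hτ hev hν, Matrix.mul_inv_rev, Matrix.mul_inv_rev,
    Matrix.transpose_mul, Matrix.transpose_mul, Matrix.transpose_transpose]
  set T := transitionMatrix τ u
  have hT' : IsUnit T.transpose.det := by rwa [Matrix.det_transpose]
  -- The factors `Tᵀ⁻¹ Tᵀ` cancel inside, and cyclicity of the trace cancels `T⁻¹` against `T`.
  calc _ = (T⁻¹ * ((ψ.metric (τ u))⁻¹ * ((T.transpose⁻¹ * T.transpose) *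
        ((ψ.curvature ν (τ u)).transpose * T)))).trace := by simp only [Matrix.mul_assoc]
    _ = _ := by
      rw [Matrix.nonsing_inv_mul _ hT', Matrix.one_mul, Matrix.trace_mul_comm, Matrix.mul_assoc,
        Matrix.mul_assoc, Matrix.mul_nonsing_inv _ hT, Matrix.mul_one]

end SurfaceChart

open SurfaceChart

variable {S P : Set Space} {φ ψ : SurfaceChart S} {u v : Plane}

theorem IsUnitNormal.inner_basis {ν : Space} (hν : IsUnitNormal S (φ.toFun u) ν)
    (hu : u ∈ φ.source) (α : Fin 2) : inner ℝ ν (φ.basis α u) = 0 :=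
  hν.2 _ ⟨φ, u, hu, rfl, _, rfl⟩

theorem meanCurvature_eq_traceCurvature {ν : Space} (hν : IsUnitNormal S (φ.toFun u) ν)
    (hu : u ∈ φ.source) : meanCurvature S (φ.toFun u) ν = φ.traceCurvature ν u := by
  have h : ∃ x : SurfaceChart S × Plane, x.2 ∈ x.1.source ∧ x.1.toFun x.2 = φ.toFun u :=
    ⟨(φ, u), hu, rfl⟩
  rw [meanCurvature, dif_pos h]
  exact traceCurvature_eq_of_toFun_eq h.choose_spec.1 hu h.choose_spec.2
    fun γ => hν.inner_basis hu γ

/-- In an adapted chart, the contour is given by `u⁰ = 0`. -/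
theorem toFun_mem_contour_iff (hφ : φ.IsAdapted P) (hu : u ∈ φ.source) :
    φ.toFun u ∈ contour S P ↔ u 0 = 0 := by
  constructor
  · rintro ⟨hP, hcl⟩
    refine le_antisymm ((hφ u hu).1 hP) (not_lt.1 fun hneg => ?_)
    -- If `u⁰ < 0`, a whole neighbourhood of the point in `S` lies in `P`, so the point is not in
    -- the closure of `S \ P`.
    have hN : {w : Plane | w 0 < 0} ∈ 𝓝 u :=
      (isOpen_lt (by fun_prop) continuous_const).mem_nhds hneg
    have h1 := image_mem_nhdsWithin hu hN
    rw [mem_nhdsWithin] at h1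
    obtain ⟨O, hO, huO, hsub⟩ := h1
    obtain ⟨p, hpO, hpS, hpP⟩ := mem_closure_iff.1 hcl O hO huO
    obtain ⟨w, ⟨hw, hw0⟩, rfl⟩ := hsub ⟨hpO, hpS⟩
    exact hpP ((hφ w hw).2 (le_of_lt hw0))
  · intro h0
    refine ⟨(hφ u hu).2 h0.le, ?_⟩
    -- Conversely, a point with `u⁰ = 0` is approached from the side `u⁰ > 0`, which lies outside
    -- `P`.
    have hlim : Tendsto (fun t : ℝ => φ.toFun (u + t • EuclideanSpace.single 0 1)) (𝓝[>] 0)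
        (𝓝 (φ.toFun u)) := by
      have h1 : Tendsto (fun t : ℝ => u + t • (EuclideanSpace.single 0 1 : Plane)) (𝓝 0)
          (𝓝 (u + (0 : ℝ) • EuclideanSpace.single 0 1)) :=
        (by fun_prop : Continuous fun t : ℝ => u + t • (EuclideanSpace.single 0 1 : Plane)).tendsto 0
      rw [zero_smul, add_zero] at h1
      exact ((contDiffAt hu).continuousAt.tendsto.comp h1).mono_left nhdsWithin_le_nhds
    have hsrc : ∀ᶠ t : ℝ in 𝓝[>] 0, u + t • (EuclideanSpace.single 0 1 : Plane) ∈ φ.source := by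
      have h1 : Continuous fun t : ℝ => u + t • (EuclideanSpace.single 0 1 : Plane) := by fun_prop
      exact nhdsWithin_le_nhds (h1.continuousAt.preimage_mem_nhds
        (φ.isOpen_source.mem_nhds (by simpa using hu)))
    refine mem_closure_of_tendsto hlim ?_
    filter_upwards [hsrc, self_mem_nhdsWithin] with t ht ht0
    refine ⟨toFun_mem ht, fun hP => ?_⟩
    have := (hφ _ ht).1 hP
    simp [h0] at this
    exact absurd this (not_le.2 ht0)

theorem IsTangentTo.exists_sum_basis {w : Space} (hw : IsTangentTo S (ψ.toFun v) w)
    (hv : v ∈ ψ.source) : ∃ x y : ℝ, w = x • ψ.basis 0 v + y • ψ.basis 1 v := by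
  obtain ⟨φ, u, hu, huv, z, rfl⟩ := hw
  obtain ⟨τ, hτ, rfl, hev⟩ := exists_transition hu hv huv
  refine ⟨(fderiv ℝ τ u z) 0, (fderiv ℝ τ u z) 1, ?_⟩
  rw [fderiv_eq_comp_transition hτ hev, ContinuousLinearMap.comp_apply, fderiv_eq_sum_basis,
    Fin.sum_univ_two]

/-- The outward conormal, in terms of any adapted chart. -/
theorem IsOutwardConormal.inner_basis {n : Space} (hn : IsOutwardConormal S P (ψ.toFun v) n)
    (hψ : ψ.IsAdapted P) (hv : v ∈ ψ.source) (hc : ψ.toFun v ∈ contour S P) :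
    inner ℝ n (ψ.basis 1 v) = 0 ∧ 0 < inner ℝ n (ψ.basis 0 v) := by
  -- The conormal conditions are given in some adapted chart `φ` and have to be carried over to `ψ`.
  -- Since the transition map preserves the half plane, the derivative of `τ⁰` vanishes along the
  -- boundary line and is nonnegative across it.
  obtain ⟨-, -, φ, hφ, u, hu, huv, hn1, hn0⟩ := hn
  obtain ⟨τ, hτ, hτu, hev⟩ := exists_transition hu hv huv
  have hu0 : u 0 = 0 := (toFun_mem_contour_iff hφ hu).1 (huv ▸ hc)
  have hv0 : v 0 = 0 := (toFun_mem_contour_iff hψ hv).1 hc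
  have hT := injective_fderiv_transition hτ hev
  -- the transition map preserves the half plane
  have hhalf : ∀ᶠ x in 𝓝 u, (x 0 ≤ 0 → (τ x) 0 ≤ 0) := by
    filter_upwards [hev] with x hx hx0
    have := (hφ x hx.1).2 hx0
    rw [← hx.2.2] at this
    exact (hψ _ hx.2.1).1 this
  have hline : ∀ w : Plane, HasDerivAt (fun t : ℝ => (τ (u + t • w)) 0) ((fderiv ℝ τ u w) 0) 0 := by
    intro w
    have h1 : HasDerivAt (fun t : ℝ => u + t • w) w 0 := by
      simpa using ((hasDerivAt_id (0 : ℝ)).smul_const w).const_add u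
    have h2 : HasFDerivAt τ (fderiv ℝ τ u) (u + (0 : ℝ) • w) := by
      simpa using (hτ.differentiableAt (by simp)).hasFDerivAt
    have h3 := h2.comp_hasDerivAt (0 : ℝ) h1
    exact ((EuclideanSpace.proj (0 : Fin 2) : Plane →L[ℝ] ℝ).hasFDerivAt.comp_hasDerivAt
      (0 : ℝ) h3)
  have hev_line : ∀ w : Plane, ∀ᶠ t : ℝ in 𝓝 0,
      ((u + t • w) 0 ≤ 0 → (τ (u + t • w)) 0 ≤ 0) := by
    intro w
    have h1 : Continuous fun t : ℝ => u + t • w := by fun_prop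
    have h2 := h1.tendsto 0
    simp only [zero_smul, add_zero] at h2
    exact h2.eventually hhalf
  have hτu0 : (τ u) 0 = 0 := by rw [hτu, hv0]
  -- along the contour
  have h1 : (fderiv ℝ τ u (EuclideanSpace.single 1 1)) 0 = 0 := by
    refine IsLocalMax.hasDerivAt_eq_zero ?_ (hline _)
    filter_upwards [hev_line (EuclideanSpace.single 1 1)] with t ht
    simp only [zero_smul, add_zero, hτu0]
    exact ht (by simp [hu0])
  -- across the contour
  have h0 : 0 ≤ (fderiv ℝ τ u (EuclideanSpace.single 0 1)) 0 := by
    have hd := (hline (EuclideanSpace.single 0 1)).tendsto_slope_zero_left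
    refine ge_of_tendsto hd ?_
    filter_upwards [nhdsWithin_le_nhds (hev_line (EuclideanSpace.single 0 1)),
      self_mem_nhdsWithin] with t ht ht0
    have ht0' : t < 0 := ht0
    simp only [zero_add, zero_smul, add_zero, hτu0, sub_zero, smul_eq_mul]
    refine mul_nonneg_of_nonpos_of_nonpos (inv_nonpos.2 ht0'.le) (ht ?_)
    simp [hu0, ht0'.le]
  have h11 : (fderiv ℝ τ u (EuclideanSpace.single 1 1)) 1 ≠ 0 := by
    intro h
    have : fderiv ℝ τ u (EuclideanSpace.single 1 1) = 0 := by
      ext i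
      fin_cases i
      · exact h1
      · exact h
    have := (injective_iff_map_eq_zero _).1 hT _ this
    simpa using congrArg (fun w : Plane => w 1) this
  -- The Jacobian is triangular: `φ.basis 1` is a nonzero multiple of `ψ.basis 1`, and modulo that
  -- vector `φ.basis 0` is a nonnegative multiple of `ψ.basis 0`. The multiple is nonzero because
  -- its product with `n` is positive.
  have hb1 := basis_eq_sum_transition hτ hev 1
  have hb0 := basis_eq_sum_transition hτ hev 0
  rw [hτu, Fin.sum_univ_two] at hb1 hb0
  rw [h1, zero_smul, zero_add] at hb1
  rw [hb1, real_inner_smul_right] at hn1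
  have hn1' : inner ℝ n (ψ.basis 1 v) = 0 := (mul_eq_zero.1 hn1).resolve_left h11
  rw [hb0, inner_add_right, real_inner_smul_right, real_inner_smul_right, hn1', mul_zero,
    add_zero] at hn0
  exact ⟨hn1', (pos_iff_pos_of_mul_pos hn0).1
    (lt_of_le_of_ne h0 fun h => by rw [← h, zero_mul] at hn0; exact hn0.false)⟩

end Transition

/-! ### The divergence of the scaled dual basis, and its boundary value -/

section Flux

open Filter Module
open scoped Topology

namespace SurfaceChart

variable {S : Set Space} {φ : SurfaceChart S} {u : Plane}

/-- The density of the area of a surface in the parameters of a chart. -/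
noncomputable def density (φ : SurfaceChart S) (u : Plane) : ℝ := √(φ.metric u).det

theorem normDet_fderiv (u : Plane) : (fderiv ℝ φ.toFun u).toLinearMap.normDet = φ.density u := by
  rw [LinearMap.normDet_eq_sqrt _ (EuclideanSpace.basisFun (Fin 2) ℝ)]
  simp only [EuclideanSpace.basisFun_apply]
  rfl

theorem density_pos (hu : u ∈ φ.source) : 0 < φ.density u := by
  rw [← normDet_fderiv]
  exact lt_of_le_of_ne (LinearMap.normDet_nonneg _)
    (Ne.symm (((LinearMap.normDet_ne_zero_tfae (fderiv ℝ φ.toFun u).toLinearMap).out 0 4).2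
      (φ.immersion u hu)))

theorem det_metric_pos (hu : u ∈ φ.source) : 0 < (φ.metric u).det :=
  Real.sqrt_pos.1 (density_pos hu)

theorem density_mul_self (hu : u ∈ φ.source) : φ.density u * φ.density u = (φ.metric u).det :=
  Real.mul_self_sqrt (det_metric_pos hu).le

theorem metric_comm (α β : Fin 2) : φ.metric u α β = φ.metric u β α := by
  rw [metric, Matrix.of_apply, Matrix.of_apply, real_inner_comm]

/-- The contravariant basis vectors, scaled by the density. -/
noncomputable def flux (φ : SurfaceChart S) (α : Fin 2) (u : Plane) : Space :=
  ∑ β, (φ.density u * (φ.metric u)⁻¹ α β) • φ.basis β u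

theorem contDiffOn_metric (α β : Fin 2) : ContDiffOn ℝ ∞ (fun u => φ.metric u α β) φ.source :=
  (contDiffOn_basis α).inner ℝ (contDiffOn_basis β)

theorem contDiffOn_det_metric : ContDiffOn ℝ ∞ (fun u => (φ.metric u).det) φ.source := by
  simp_rw [Matrix.det_fin_two]
  exact ((contDiffOn_metric 0 0).mul (contDiffOn_metric 1 1)).sub
    ((contDiffOn_metric 0 1).mul (contDiffOn_metric 1 0))

theorem contDiffOn_density : ContDiffOn ℝ ∞ φ.density φ.source :=
  contDiffOn_det_metric.sqrt fun _ hu => (det_metric_pos hu).ne'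

theorem contDiffOn_inv_metric (α β : Fin 2) :
    ContDiffOn ℝ ∞ (fun u => (φ.metric u)⁻¹ α β) φ.source := by
  simp_rw [Matrix.inv_def, Ring.inverse_eq_inv', Matrix.smul_apply, smul_eq_mul]
  refine (contDiffOn_det_metric.inv fun _ hu => (det_metric_pos hu).ne').mul ?_
  simp_rw [Matrix.adjugate_fin_two]
  fin_cases α <;> fin_cases β
  · exact contDiffOn_metric 1 1
  · exact (contDiffOn_metric 0 1).neg
  · exact (contDiffOn_metric 1 0).neg
  · exact contDiffOn_metric 0 0

theorem contDiffOn_flux (α : Fin 2) : ContDiffOn ℝ ∞ (φ.flux α) φ.source :=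
  ContDiffOn.sum fun β _ =>
    (contDiffOn_density.mul (contDiffOn_inv_metric α β)).smul (contDiffOn_basis β)

theorem inner_flux_basis (hu : u ∈ φ.source) (α γ : Fin 2) :
    inner ℝ (φ.flux α u) (φ.basis γ u) = if α = γ then φ.density u else 0 := by
  have h := Matrix.nonsing_inv_mul (φ.metric u) (isUnit_iff_ne_zero.2 (det_metric_pos hu).ne')
  have h' := congrFun (congrFun h α) γ
  rw [Matrix.mul_apply, Matrix.one_apply] at h'
  rw [flux, sum_inner]
  simp_rw [real_inner_smul_left, mul_assoc]
  rw [← Finset.mul_sum]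
  change φ.density u * ∑ β, (φ.metric u)⁻¹ α β * φ.metric u β γ = _
  rw [h']
  split_ifs <;> simp

/-- A vector is determined by its products with the covariant basis and with a normal vector. -/
theorem ext_inner {ν w w' : Space} (hν : IsUnitNormal S (φ.toFun u) ν) (hu : u ∈ φ.source)
    (hb : ∀ γ, inner ℝ w (φ.basis γ u) = inner ℝ w' (φ.basis γ u))
    (hn : inner ℝ w ν = inner ℝ w' ν) : w = w' := by
  rw [← sub_eq_zero]
  by_contra hne
  set d := w - w' with hd
  have hdb : ∀ γ, inner ℝ d (φ.basis γ u) = 0 := fun γ => by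
    rw [hd, inner_sub_left, hb, sub_self]
  have hdn : inner ℝ d ν = 0 := by rw [hd, inner_sub_left, hn, sub_self]
  set A := fderiv ℝ φ.toFun u with hA
  have hrank : finrank ℝ A.toLinearMap.range = 2 := by
    rw [LinearMap.finrank_range_of_inj (φ.immersion u hu)]
    simp
  have hperp : ∀ z : Space, (∀ γ, inner ℝ z (φ.basis γ u) = 0) → z ∈ A.toLinearMap.rangeᗮ := by
    intro z hz
    rw [Submodule.mem_orthogonal']
    rintro _ ⟨y, rfl⟩
    have : A.toLinearMap y = fderiv ℝ φ.toFun u y := rfl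
    rw [this, fderiv_eq_sum_basis, inner_sum]
    exact Finset.sum_eq_zero fun γ _ => by rw [real_inner_smul_right, hz, mul_zero]
  -- The normal space is a line. A nonzero difference `d` would span it, so `ν` would be a multiple
  -- of `d`; but `d` is orthogonal to `ν`, which would force `ν = 0`.
  have hrank' : finrank ℝ A.toLinearMap.rangeᗮ = 1 := by
    have := A.toLinearMap.range.finrank_add_finrank_orthogonal
    rw [hrank] at this
    simp at this
    omega
  have hdm : d ∈ A.toLinearMap.rangeᗮ := hperp d hdb
  have hνm : ν ∈ A.toLinearMap.rangeᗮ := hperp ν fun γ => hν.inner_basis hu γ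
  obtain ⟨c, hc⟩ := (finrank_eq_one_iff_of_nonzero' (⟨d, hdm⟩ : A.toLinearMap.rangeᗮ)
    (by simpa using hne)).1 hrank' ⟨ν, hνm⟩
  have hc' : c • d = ν := congrArg Subtype.val hc
  have : inner ℝ ν ν = 0 := by
    nth_rewrite 1 [← hc']
    rw [real_inner_smul_left, hdn, mul_zero]
  rw [inner_self_eq_zero] at this
  have h1 := hν.1
  rw [this, norm_zero] at h1
  exact zero_ne_one h1

theorem inner_flux_normal {ν : Space} (hν : IsUnitNormal S (φ.toFun u) ν) (hu : u ∈ φ.source)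
    (α : Fin 2) : inner ℝ (φ.flux α u) ν = 0 := by
  rw [flux, sum_inner]
  refine Finset.sum_eq_zero fun β _ => ?_
  rw [real_inner_smul_left, real_inner_comm, hν.inner_basis hu, mul_zero]

/-- The tangential part of a vector, in terms of the contravariant basis. -/
theorem sum_inner_smul_flux {ν : Space} (hν : IsUnitNormal S (φ.toFun u) ν) (hu : u ∈ φ.source)
    (w : Space) : ∑ α, (inner ℝ w (φ.basis α u) : ℝ) • φ.flux α u =
      φ.density u • (w - (inner ℝ ν w : ℝ) • ν) := by
  refine ext_inner hν hu (fun γ => ?_) ?_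
  · rw [sum_inner]
    simp_rw [real_inner_smul_left, inner_flux_basis hu]
    rw [inner_sub_left, real_inner_smul_left, hν.inner_basis hu]
    simp [mul_comm]
  · rw [sum_inner]
    simp_rw [real_inner_smul_left, inner_flux_normal hν hu]
    rw [inner_sub_left, real_inner_smul_left, real_inner_self_eq_norm_sq, hν.1,
      real_inner_comm]
    simp

theorem inv_metric_comm (α β : Fin 2) : (φ.metric u)⁻¹ α β = (φ.metric u)⁻¹ β α := by
  have h : (φ.metric u).IsSymm := by
    ext i j
    exact metric_comm j i
  have h' : (φ.metric u)⁻¹.IsSymm := by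
    rw [Matrix.IsSymm, Matrix.transpose_nonsing_inv, h.eq]
  exact h'.apply β α

/-- Both sides are mixed second derivatives of the parametrization. -/
theorem fderiv_basis_comm (hu : u ∈ φ.source) (α β : Fin 2) :
    fderiv ℝ (φ.basis α) u (EuclideanSpace.single β 1) =
      fderiv ℝ (φ.basis β) u (EuclideanSpace.single α 1) := by
  have hd : DifferentiableAt ℝ (fderiv ℝ φ.toFun) u :=
    ((contDiffAt hu).fderiv_right (m := 1)
      (ENat.LEInfty.out : (2 : ℕ∞ω) ≤ ∞)).differentiableAt (by simp)
  have h : ∀ γ δ : Fin 2, fderiv ℝ (φ.basis γ) u (EuclideanSpace.single δ 1) =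
      fderiv ℝ (fderiv ℝ φ.toFun) u (EuclideanSpace.single δ 1) (EuclideanSpace.single γ 1) := by
    intro γ δ
    have := (hd.hasFDerivAt.clm_apply
      (hasFDerivAt_const (EuclideanSpace.single γ 1 : Plane) u)).fderiv
    change fderiv ℝ (fun y => fderiv ℝ φ.toFun y (EuclideanSpace.single γ 1)) u _ = _
    rw [this]
    simp
  rw [h, h]
  exact ((contDiffAt hu).isSymmSndFDerivAt
    (by simpa using (ENat.LEInfty.out : (2 : ℕ∞ω) ≤ ∞))).eq _ _

theorem differentiableAt_basis (hu : u ∈ φ.source) (α : Fin 2) :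
    DifferentiableAt ℝ (φ.basis α) u :=
  (hasFDerivAt_basis hu α).differentiableAt

theorem differentiableAt_flux (hu : u ∈ φ.source) (α : Fin 2) :
    DifferentiableAt ℝ (φ.flux α) u :=
  ((contDiffOn_flux α).contDiffAt (φ.isOpen_source.mem_nhds hu)).differentiableAt (by simp)

theorem hasDerivAt_metric (hu : u ∈ φ.source) (α β : Fin 2) (w : Plane) :
    HasDerivAt (fun t : ℝ => φ.metric (u + t • w) α β)
      (inner ℝ (φ.basis α u) (fderiv ℝ (φ.basis β) u w) +
        inner ℝ (fderiv ℝ (φ.basis α) u w) (φ.basis β u)) 0 := by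
  have hl : HasDerivAt (fun t : ℝ => u + t • w) w 0 := by
    simpa using ((hasDerivAt_id (0 : ℝ)).smul_const w).const_add u
  have hb : ∀ γ, HasDerivAt (fun t : ℝ => φ.basis γ (u + t • w)) (fderiv ℝ (φ.basis γ) u w) 0 := by
    intro γ
    have h2 : HasFDerivAt (φ.basis γ) (fderiv ℝ (φ.basis γ) u) (u + (0 : ℝ) • w) := by
      simpa using hasFDerivAt_basis hu γ
    exact h2.comp_hasDerivAt (0 : ℝ) hl
  simp only [metric, Matrix.of_apply]
  simpa using (hb α).inner ℝ (hb β)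

/-- This is Jacobi's formula `∂√S = ½ √S S^{αβ} ∂S_{αβ}`; the two terms of `∂S_{αβ}` contribute
equally because the metric is symmetric. -/
theorem fderiv_density (hu : u ∈ φ.source) (w : Plane) :
    fderiv ℝ φ.density u w =
      ∑ α, inner ℝ (φ.flux α u) (fderiv ℝ (φ.basis α) u w) := by
  have hd : HasFDerivAt φ.density (fderiv ℝ φ.density u) u :=
    ((contDiffOn_density.contDiffAt (φ.isOpen_source.mem_nhds hu)).differentiableAt
      (by simp)).hasFDerivAt
  have hl : HasDerivAt (fun t : ℝ => u + t • w) w 0 := by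
    simpa using ((hasDerivAt_id (0 : ℝ)).smul_const w).const_add u
  have h2 : HasFDerivAt φ.density (fderiv ℝ φ.density u) (u + (0 : ℝ) • w) := by
    simpa using hd
  have h3 := h2.comp_hasDerivAt (0 : ℝ) hl
  have hm := hasDerivAt_metric hu (w := w)
  have h4 := ((hm 0 0).mul (hm 1 1)).sub ((hm 0 1).mul (hm 1 0))
  have h5 := h4.sqrt (by
    have := (det_metric_pos hu).ne'
    rw [Matrix.det_fin_two] at this
    simpa using this)
  have h6 : (fun t : ℝ => √(((fun t : ℝ => φ.metric (u + t • w) 0 0) *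
      (fun t : ℝ => φ.metric (u + t • w) 1 1) - (fun t : ℝ => φ.metric (u + t • w) 0 1) *
      fun t : ℝ => φ.metric (u + t • w) 1 0) t)) = φ.density ∘ fun t : ℝ => u + t • w := by
    ext t
    simp [density, Matrix.det_fin_two]
  rw [h6] at h5
  rw [h3.unique h5]
  have hpos := density_pos hu
  have hdd := density_mul_self hu
  have hdet : (φ.metric u).det ≠ 0 := (det_metric_pos hu).ne'
  simp only [Pi.sub_apply, Pi.mul_apply, zero_smul, add_zero]
  rw [← Matrix.det_fin_two (φ.metric u)]
  change _ / (2 * φ.density u) = _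
  simp only [Fin.sum_univ_two, flux, inner_add_left, real_inner_smul_left, Matrix.inv_def,
    Ring.inverse_eq_inv', Matrix.smul_apply, smul_eq_mul, Matrix.adjugate_fin_two, Matrix.of_apply,
    Matrix.cons_val', Matrix.cons_val_zero, Matrix.cons_val_one, Matrix.cons_val_fin_one]
  rw [real_inner_comm (φ.basis 0 u) (fderiv ℝ (φ.basis 0) u w),
    real_inner_comm (φ.basis 1 u) (fderiv ℝ (φ.basis 0) u w),
    real_inner_comm (φ.basis 0 u) (fderiv ℝ (φ.basis 1) u w),
    real_inner_comm (φ.basis 1 u) (fderiv ℝ (φ.basis 1) u w),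
    metric_comm 1 0, ← hdd]
  field_simp
  ring

/-- The divergence of the scaled contravariant basis is the mean curvature vector. -/
theorem sum_fderiv_flux {ν : Space} (hν : IsUnitNormal S (φ.toFun u) ν) (hu : u ∈ φ.source) :
    ∑ α, fderiv ℝ (φ.flux α) u (EuclideanSpace.single α 1) =
      (φ.density u * φ.traceCurvature ν u) • ν := by
  refine ext_inner hν hu (fun γ => ?_) ?_
  -- Tangential components: differentiate `√S S^α · S_γ = √S δ^α_γ` and replace `∂_α S_γ` by `∂_γ
  -- S_α`. The sum over `α` is `∂_γ √S` minus its expression in `fderiv_density`.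
  · have h : ∀ α : Fin 2, inner ℝ (fderiv ℝ (φ.flux α) u (EuclideanSpace.single α 1))
        (φ.basis γ u) = (if α = γ then fderiv ℝ φ.density u (EuclideanSpace.single α 1) else 0) -
          inner ℝ (φ.flux α u) (fderiv ℝ (φ.basis α) u (EuclideanSpace.single γ 1)) := by
      intro α
      have h1 := fderiv_inner_apply ℝ (differentiableAt_flux hu α) (differentiableAt_basis hu γ)
        (EuclideanSpace.single α 1)
      have h2 : (fun y => inner ℝ (φ.flux α y) (φ.basis γ y)) =ᶠ[𝓝 u]
          fun y => if α = γ then φ.density y else 0 := by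
        filter_upwards [φ.isOpen_source.mem_nhds hu] with y hy using inner_flux_basis hy α γ
      rw [h2.fderiv_eq] at h1
      rw [fderiv_basis_comm hu α γ, eq_sub_iff_add_eq', ← h1]
      split_ifs
      · rfl
      · simp
    rw [sum_inner, Finset.sum_congr rfl fun α _ => h α, Finset.sum_sub_distrib,
      Finset.sum_ite_eq' Finset.univ γ, if_pos (Finset.mem_univ _), fderiv_density hu,
      sub_self, real_inner_smul_left, hν.inner_basis hu, mul_zero]
  -- Normal component: derivatives of the coefficients multiply the vectors `S_β`, which are
  -- orthogonal to the fixed vector `ν`. Only `√S S^{αβ} ν · ∂_α S_β` remains.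
  · have h : ∀ α : Fin 2, inner ℝ (fderiv ℝ (φ.flux α) u (EuclideanSpace.single α 1)) ν =
        ∑ β, φ.density u * (φ.metric u)⁻¹ β α * φ.curvature ν u β α := by
      intro α
      have hc : ∀ β, DifferentiableAt ℝ (fun u => φ.density u * (φ.metric u)⁻¹ α β) u := fun β =>
        ((contDiffOn_density.mul (contDiffOn_inv_metric α β)).contDiffAt
          (φ.isOpen_source.mem_nhds hu)).differentiableAt (by simp)
      have hs : fderiv ℝ (φ.flux α) u = _ :=
        (HasFDerivAt.fun_sum (u := Finset.univ) fun (β : Fin 2) _ =>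
          (hc β).hasFDerivAt.smul (hasFDerivAt_basis hu β)).fderiv
      rw [hs, sum_apply, sum_inner]
      refine Finset.sum_congr rfl fun β _ => ?_
      rw [add_apply, smul_apply, ContinuousLinearMap.smulRight_apply, inner_add_left,
        real_inner_smul_left, real_inner_smul_left, real_inner_comm ν, real_inner_comm ν,
        hν.inner_basis hu, mul_zero, add_zero, inv_metric_comm]
      rfl
    rw [sum_inner, Finset.sum_congr rfl fun α _ => h α, Finset.sum_comm, real_inner_smul_left,
      real_inner_self_eq_norm_sq, hν.1, traceCurvature, Finset.mul_sum]
    simp_rw [Finset.mul_sum, mul_assoc]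
    simp

/-- On the contour, the flux through the line `u⁰ = 0` is in the direction of the conormal. -/
theorem flux_zero_eq_norm_smul {P : Set Space} {n : Space}
    (hn : IsOutwardConormal S P (φ.toFun u) n) (hφ : φ.IsAdapted P) (hu : u ∈ φ.source)
    (hc : φ.toFun u ∈ contour S P) : φ.flux 0 u = ‖φ.basis 1 u‖ • n := by
  obtain ⟨h1, h0⟩ := hn.inner_basis hφ hu hc
  obtain ⟨x, y, hxy⟩ := hn.2.1.exists_sum_basis hu
  have hpos := density_pos hu
  set s : ℝ := inner ℝ n (φ.basis 0 u) with hs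
  -- Both sides are tangent and have the same products with `S_0` and `S_1`; their difference is
  -- therefore orthogonal to itself.
  have key : s • φ.flux 0 u = φ.density u • n := by
    rw [← sub_eq_zero]
    set d := s • φ.flux 0 u - φ.density u • n with hd
    have hd0 : inner ℝ d (φ.basis 0 u) = 0 := by
      rw [hd, inner_sub_left, real_inner_smul_left, real_inner_smul_left, inner_flux_basis hu,
        if_pos rfl, ← hs]
      ring
    have hd1 : inner ℝ d (φ.basis 1 u) = 0 := by
      rw [hd, inner_sub_left, real_inner_smul_left, real_inner_smul_left, inner_flux_basis hu,
        if_neg zero_ne_one, h1]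
      ring
    rw [← inner_self_eq_zero (𝕜 := ℝ)]
    nth_rewrite 2 [hd]
    rw [flux, hxy, Fin.sum_univ_two]
    simp only [inner_sub_right, inner_add_right, real_inner_smul_right, hd0, hd1]
    ring
  -- In dimension two `S^{00} = S_{11} / det`, hence `|√S S^0|² = det · S^{00} = S_{11}`. Taking
  -- norms in `key` then gives `√S = s |S_1|`, and `s > 0` cancels.
  have hnorm : ‖φ.flux 0 u‖ = ‖φ.basis 1 u‖ := by
    rw [← sq_eq_sq₀ (norm_nonneg _) (norm_nonneg _), ← real_inner_self_eq_norm_sq,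
      ← real_inner_self_eq_norm_sq]
    nth_rewrite 2 [flux]
    rw [inner_sum, Fin.sum_univ_two, real_inner_smul_right, real_inner_smul_right,
      inner_flux_basis hu, inner_flux_basis hu, if_pos rfl, if_neg zero_ne_one, mul_zero, add_zero,
      Matrix.inv_def, Ring.inverse_eq_inv', Matrix.smul_apply, Matrix.adjugate_fin_two,
      ← density_mul_self hu]
    simp only [smul_eq_mul, Matrix.of_apply, Matrix.cons_val', Matrix.cons_val_zero,
      Matrix.cons_val_fin_one]
    field_simp
    rfl
  have h2 := congrArg norm key
  rw [norm_smul, norm_smul, hn.1, hnorm, Real.norm_of_nonneg h0.le, Real.norm_of_nonneg hpos.le,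
    mul_one] at h2
  rw [← h2, mul_smul] at key
  exact smul_right_injective _ h0.ne' key

end SurfaceChart

end Flux

/-! ### The identity for functions supported in one adapted chart -/

section LocalIdentity

open Filter Module
open scoped Topology Gradient

section Extension

variable {E F : Type*} [NormedAddCommGroup E] [NormedAddCommGroup F] {U C : Set E} {g : E → F}

theorem indicator_eventuallyEq_zero (hC : IsCompact C) (h0 : ∀ x ∈ U, x ∉ C → g x = 0) {x : E}
    (hx : x ∉ C) : U.indicator g =ᶠ[𝓝 x] fun _ => 0 := by
  filter_upwards [hC.isClosed.isOpen_compl.mem_nhds hx] with y hy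
  by_cases hyU : y ∈ U
  · rw [indicator_of_mem hyU, h0 y hyU hy]
  · rw [indicator_of_notMem hyU]

theorem indicator_eventuallyEq_of_isOpen (hU : IsOpen U) {x : E} (hx : x ∈ U) :
    U.indicator g =ᶠ[𝓝 x] g := by
  filter_upwards [hU.mem_nhds hx] with y hy using indicator_of_mem hy g

theorem hasCompactSupport_indicator (hC : IsCompact C) (h0 : ∀ x ∈ U, x ∉ C → g x = 0) :
    HasCompactSupport (U.indicator g) :=
  HasCompactSupport.intro hC fun _ hx => (indicator_eventuallyEq_zero hC h0 hx).self_of_nhds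

variable [NormedSpace ℝ E] [NormedSpace ℝ F]

/-- `U` and the complement of `C` are open and cover the space. The extension by zero is `g` near
points of the first and `0` near points of the second. -/
theorem contDiff_indicator {n : ℕ∞ω} (hU : IsOpen U) (hC : IsCompact C) (hCU : C ⊆ U)
    (hg : ContDiffOn ℝ n g U) (h0 : ∀ x ∈ U, x ∉ C → g x = 0) : ContDiff ℝ n (U.indicator g) := by
  rw [contDiff_iff_contDiffAt]
  intro x
  by_cases hx : x ∈ U
  · exact (hg.contDiffAt (hU.mem_nhds hx)).congr_of_eventuallyEq
      (indicator_eventuallyEq_of_isOpen hU hx)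
  · exact contDiffAt_const.congr_of_eventuallyEq
      (indicator_eventuallyEq_zero hC h0 fun h => hx (hCU h))

end Extension

namespace SurfaceChart

variable {S P : Set Space} {φ : SurfaceChart S} {C : Set Plane} {Q : Space → Space}

/-- The integral over a patch of a field supported in a chart, in the parameters. -/
theorem integral_patch_eq (hP : IsRegularPatch S P) (hφ : φ.IsAdapted P) (hCs : C ⊆ φ.source)
    (hQ : ∀ p ∈ P, p ∉ φ.toFun '' C → Q p = 0) {Y : Plane → Space} (hY : Continuous Y)
    (hYc : HasCompactSupport Y) (hY0 : ∀ u ∉ φ.source, Y u = 0)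
    (hYQ : ∀ u ∈ φ.source, u 0 ≤ 0 → φ.density u • Q (φ.toFun u) = Y u) :
    IntegrableOn Q P μHE[2] ∧ ∫ p in P, Q p ∂μHE[2] = ∫ u in {u : Plane | u 0 ≤ 0}, Y u := by
  have hH : MeasurableSet {u : Plane | u 0 ≤ 0} :=
    (isClosed_le (by fun_prop) continuous_const).measurableSet
  -- The part of the patch seen by the chart; `Q` vanishes on the rest of `P`, so the area formula
  -- on `A` suffices.
  set A : Set Plane := φ.source ∩ {u | u 0 ≤ 0} with hA
  have hAm : MeasurableSet A := φ.isOpen_source.measurableSet.inter hH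
  have hAP : φ.toFun '' A ⊆ P := by
    rintro _ ⟨u, hu, rfl⟩
    exact (hφ u hu.1).2 hu.2
  have hQA : ∀ p ∈ P \ φ.toFun '' A, Q p = 0 := by
    rintro p ⟨hp, hpA⟩
    refine hQ p hp ?_
    rintro ⟨u, hu, rfl⟩
    exact hpA ⟨u, ⟨hCs hu, (hφ u (hCs hu)).1 hp⟩, rfl⟩
  have hsm : ContDiffOn ℝ 1 φ.toFun φ.source := φ.smooth.of_le (by simp)
  have hPm : MeasurableSet P := hP.isCompact.isClosed.measurableSet
  have hfin : finrank ℝ Plane = 2 := by simp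
  have h1 := integrableOn_image_iff_integrableOn_normDet_smul φ.isOpen_source hsm φ.immersion
    φ.injOn hAm inter_subset_left Q
  have h2 := integral_image_eq_integral_normDet_smul φ.isOpen_source hsm φ.immersion
    φ.injOn hAm inter_subset_left Q
  rw [hfin] at h1 h2
  simp_rw [normDet_fderiv] at h1 h2
  have hYint : Integrable Y := hY.integrable_of_hasCompactSupport hYc
  have hcongr : EqOn (fun u => φ.density u • Q (φ.toFun u)) Y A := fun u hu => hYQ u hu.1 hu.2
  constructor
  · refine IntegrableOn.of_forall_sdiff_eq_zero (h1.2 ?_) hPm hQA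
    exact (integrableOn_congr_fun hcongr hAm).2 hYint.integrableOn
  · rw [setIntegral_eq_of_subset_of_forall_sdiff_eq_zero hPm hAP hQA, h2,
      setIntegral_congr_fun hAm hcongr]
    refine (setIntegral_eq_of_subset_of_forall_sdiff_eq_zero hH inter_subset_right ?_).symm
    rintro u ⟨hu, huA⟩
    exact hY0 u fun hs => huA ⟨hs, hu⟩

theorem hasDerivAt_boundaryCurve {t : ℝ} (ht : !₂[0, t] ∈ φ.source) :
    HasDerivAt (fun t : ℝ => φ.toFun !₂[0, t]) (φ.basis 1 !₂[0, t]) t :=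
  (hasFDerivAt ht).comp_hasDerivAt t (hasDerivAt_planeMk_right 0 t)

theorem normDet_fderiv_real {γ : ℝ → Space} {v : Space} {t : ℝ} (h : HasDerivAt γ v t) :
    (fderiv ℝ γ t).toLinearMap.normDet = ‖v‖ := by
  rw [LinearMap.normDet_eq_sqrt _ (OrthonormalBasis.singleton Unit ℝ), Matrix.det_unique,
    Matrix.of_apply, OrthonormalBasis.singleton_apply]
  have : (fderiv ℝ γ t).toLinearMap (1 : ℝ) = v := by
    rw [← h.deriv]
    rfl
  rw [this, real_inner_self_eq_norm_sq, Real.sqrt_sq (norm_nonneg _)]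

/-- The integral over a contour of a field supported in a chart, in the parameters. -/
theorem integral_contour_eq (hP : IsRegularPatch S P) (hφ : φ.IsAdapted P) (hCs : C ⊆ φ.source)
    (hQ : ∀ p ∈ P, p ∉ φ.toFun '' C → Q p = 0) {Y : ℝ → Space} (hY : Continuous Y)
    (hYc : HasCompactSupport Y) (hY0 : ∀ t, !₂[0, t] ∉ φ.source → Y t = 0)
    (hYQ : ∀ t, !₂[0, t] ∈ φ.source → ‖φ.basis 1 !₂[0, t]‖ • Q (φ.toFun !₂[0, t]) = Y t) :
    IntegrableOn Q (contour S P) μHE[1] ∧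
      ∫ p in contour S P, Q p ∂μHE[1] = ∫ t, Y t := by
  set U : Set ℝ := {t | !₂[0, t] ∈ φ.source} with hU
  set γ : ℝ → Space := fun t => φ.toFun !₂[0, t] with hγ
  have hUo : IsOpen U := φ.isOpen_source.preimage (by fun_prop)
  have hsm : ContDiffOn ℝ 1 γ U :=
    (φ.smooth.of_le (by simp)).comp
      (contDiff_planeMk.comp (contDiff_prodMk_right (0 : ℝ))).contDiffOn fun t ht => ht
  have hd : ∀ t ∈ U, HasDerivAt γ (φ.basis 1 !₂[0, t]) t := fun t ht => hasDerivAt_boundaryCurve ht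
  have himm : ∀ t ∈ U, Function.Injective (fderiv ℝ γ t) := by
    intro t ht
    rw [injective_iff_map_eq_zero]
    intro x hx
    rw [(hd t ht).hasFDerivAt.fderiv] at hx
    have hb : φ.basis 1 !₂[0, t] ≠ 0 := by
      intro h
      have := (injective_iff_map_eq_zero _).1 (φ.immersion _ ht) _ h
      simpa using congrArg (fun w : Plane => w 1) this
    simpa [hb] using hx
  have hinj : InjOn γ U := by
    intro t ht t' ht' h
    have := φ.injOn ht ht' h
    simpa using congrArg (fun w : Plane => w 1) this
  have hc : ∀ t ∈ U, γ t ∈ contour S P := fun t ht => (toFun_mem_contour_iff hφ ht).2 (by simp)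
  have hAP : γ '' U ⊆ contour S P := by
    rintro _ ⟨t, ht, rfl⟩
    exact hc t ht
  have hQA : ∀ p ∈ contour S P \ γ '' U, Q p = 0 := by
    rintro p ⟨hp, hpA⟩
    refine hQ p hp.1 ?_
    rintro ⟨u, hu, rfl⟩
    have h0 := (toFun_mem_contour_iff hφ (hCs hu)).1 hp
    have hu' : !₂[0, u 1] = u := by
      ext i
      fin_cases i
      · simp [h0]
      · simp
    refine hpA ⟨u 1, ?_, ?_⟩
    · rw [hU, mem_ofPred_eq, hu']
      exact hCs hu
    · simp only [hγ, hu']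
  have hPm : MeasurableSet (contour S P) :=
    (hP.isCompact.isClosed.inter isClosed_closure).measurableSet
  have hfin : finrank ℝ ℝ = 1 := by simp
  have h1 := integrableOn_image_iff_integrableOn_normDet_smul hUo hsm himm hinj
    hUo.measurableSet subset_rfl Q
  have h2 := integral_image_eq_integral_normDet_smul hUo hsm himm hinj
    hUo.measurableSet subset_rfl Q
  rw [hfin] at h1 h2
  have hYint : Integrable Y := hY.integrable_of_hasCompactSupport hYc
  have hcongr : EqOn (fun t => (fderiv ℝ γ t).toLinearMap.normDet • Q (γ t)) Y U := by
    intro t ht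
    simp only
    rw [normDet_fderiv_real (hd t ht)]
    exact hYQ t ht
  constructor
  · refine IntegrableOn.of_forall_sdiff_eq_zero (h1.2 ?_) hPm hQA
    exact (integrableOn_congr_fun hcongr hUo.measurableSet).2 hYint.integrableOn
  · rw [setIntegral_eq_of_subset_of_forall_sdiff_eq_zero hPm hAP hQA, h2,
      setIntegral_congr_fun hUo.measurableSet hcongr, setIntegral_eq_integral_of_forall_compl_eq_zero]
    exact fun t ht => hY0 t ht

end SurfaceChart

open SurfaceChart

/-- The part of the gradient of `ρ` that is tangent to a surface with normal field `N`. -/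
noncomputable def tangentialGradient (N : Space → Space) (ρ : Space → ℝ) (p : Space) : Space :=
  ∇ ρ p - (inner ℝ (N p) (∇ ρ p) : ℝ) • N p

/-- The divergence theorem for a function supported in an adapted chart. -/
theorem integral_smul_meanCurvature_add_tangentialGradient {S P : Set Space}
    (hP : IsRegularPatch S P)
    {N : Space → Space} (hN : ∀ p ∈ P, IsUnitNormal S p (N p))
    {n : Space → Space} (hn : ∀ p ∈ contour S P, IsOutwardConormal S P p (n p))
    {φ : SurfaceChart S} (hφ : φ.IsAdapted P) {C : Set Plane} (hC : IsCompact C)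
    (hCs : C ⊆ φ.source) {ρ : Space → ℝ} (hρ : ContDiff ℝ ∞ ρ)
    (hρC : S ∩ tsupport ρ ⊆ φ.toFun '' C) :
    IntegrableOn (fun p => ρ p • meanCurvature S p (N p) • N p) P μHE[2] ∧
    IntegrableOn (tangentialGradient N ρ) P μHE[2] ∧
    IntegrableOn (fun p => ρ p • n p) (contour S P) μHE[1] ∧
    ∫ p in P, ρ p • meanCurvature S p (N p) • N p ∂μHE[2] +
      ∫ p in P, tangentialGradient N ρ p ∂μHE[2] = ∫ p in contour S P, ρ p • n p ∂μHE[1] := by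
  have hout : ∀ p ∈ S, p ∉ φ.toFun '' C → ρ p = 0 ∧ fderiv ℝ ρ p = 0 := fun p hp hpC => by
    have : p ∉ tsupport ρ := fun h => hpC (hρC ⟨hp, h⟩)
    exact ⟨image_eq_zero_of_notMem_tsupport this, fderiv_of_notMem_tsupport ℝ this⟩
  have hout' : ∀ u ∈ φ.source, u ∉ C → ρ (φ.toFun u) = 0 ∧ fderiv ℝ ρ (φ.toFun u) = 0 := by
    intro u hu huC
    refine hout _ (toFun_mem hu) ?_
    rintro ⟨v, hv, hvu⟩
    exact huC (φ.injOn (hCs hv) hu hvu ▸ hv)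
  have hρφ : ContDiffOn ℝ ∞ (fun u => ρ (φ.toFun u)) φ.source := hρ.comp_contDiffOn φ.smooth
  -- `X` is the flux times `ρ`, extended by zero. Its divergence splits into `Y₁`, where the flux is
  -- differentiated (curvature), and `Y₂`, where `ρ` is (tangential gradient).
  set X : Fin 2 → Plane → Space := fun α =>
    φ.source.indicator fun u => ρ (φ.toFun u) • φ.flux α u with hX
  set Y₁ : Plane → Space := φ.source.indicator fun u => ρ (φ.toFun u) •
    ∑ α, fderiv ℝ (φ.flux α) u (EuclideanSpace.single α 1) with hY₁
  set Y₂ : Plane → Space := φ.source.indicator fun u =>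
    ∑ α, fderiv ℝ ρ (φ.toFun u) (φ.basis α u) • φ.flux α u with hY₂
  have hX0 : ∀ α, ∀ u ∈ φ.source, u ∉ C → ρ (φ.toFun u) • φ.flux α u = 0 :=
    fun α u hu huC => by rw [(hout' u hu huC).1, zero_smul]
  have hY₁0 : ∀ u ∈ φ.source, u ∉ C → ρ (φ.toFun u) •
      ∑ α, fderiv ℝ (φ.flux α) u (EuclideanSpace.single α 1) = 0 :=
    fun u hu huC => by rw [(hout' u hu huC).1, zero_smul]
  have hY₂0 : ∀ u ∈ φ.source, u ∉ C →
      ∑ α, fderiv ℝ ρ (φ.toFun u) (φ.basis α u) • φ.flux α u = 0 :=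
    fun u hu huC => by simp [(hout' u hu huC).2]
  have hXs : ∀ α, ContDiff ℝ 1 (X α) := fun α =>
    contDiff_indicator φ.isOpen_source hC hCs
      ((hρφ.smul (contDiffOn_flux α)).of_le (by simp)) (hX0 α)
  have hXc : ∀ α, HasCompactSupport (X α) := fun α => hasCompactSupport_indicator hC (hX0 α)
  have hY₁s : Continuous Y₁ := by
    refine (contDiff_indicator (n := 0) φ.isOpen_source hC hCs ?_ hY₁0).continuous
    refine (hρφ.of_le (by simp)).smul (ContDiffOn.sum fun α _ => ?_)
    exact (((contDiffOn_flux α).fderiv_of_isOpen (m := ∞) φ.isOpen_source (by simp)).clm_apply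
      contDiffOn_const).of_le (by simp)
  have hY₁c : HasCompactSupport Y₁ := hasCompactSupport_indicator hC hY₁0
  have hY₂s : Continuous Y₂ := by
    refine (contDiff_indicator (n := 0) φ.isOpen_source hC hCs ?_ hY₂0).continuous
    refine ContDiffOn.of_le (n := ∞) (ContDiffOn.sum fun α _ => ?_) (by simp)
    exact (((hρ.fderiv_right (m := ∞) (by simp)).comp_contDiffOn φ.smooth).clm_apply
      (contDiffOn_basis α)).smul (contDiffOn_flux α)
  have hY₂c : HasCompactSupport Y₂ := hasCompactSupport_indicator hC hY₂0
  -- the divergence of the extended flux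
  have hdiv : ∀ u, fderiv ℝ (X 0) u (EuclideanSpace.single 0 1) +
      fderiv ℝ (X 1) u (EuclideanSpace.single 1 1) = Y₁ u + Y₂ u := by
    intro u
    by_cases hu : u ∈ φ.source
    · have h : ∀ α (w : Plane), fderiv ℝ (X α) u w = ρ (φ.toFun u) • fderiv ℝ (φ.flux α) u w +
          fderiv ℝ ρ (φ.toFun u) (fderiv ℝ φ.toFun u w) • φ.flux α u := by
        intro α w
        have h1 : HasFDerivAt (fun u => ρ (φ.toFun u))
            (fderiv ℝ ρ (φ.toFun u) ∘L fderiv ℝ φ.toFun u) u :=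
          (hρ.differentiable (by simp) _).hasFDerivAt.comp u (hasFDerivAt hu)
        have h2 := h1.smul (differentiableAt_flux hu α).hasFDerivAt
        have h3 : fderiv ℝ (X α) u = _ :=
          (indicator_eventuallyEq_of_isOpen φ.isOpen_source hu).fderiv_eq.trans h2.fderiv
        rw [h3]
        simp
      rw [h, h, hY₁, hY₂, indicator_of_mem hu, indicator_of_mem hu, Fin.sum_univ_two,
        Fin.sum_univ_two, smul_add, basis, basis]
      abel
    · have huC : u ∉ C := fun h => hu (hCs h)
      have h : ∀ α, fderiv ℝ (X α) u = 0 := fun α => by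
        rw [(indicator_eventuallyEq_zero hC (hX0 α) huC).fderiv_eq]
        simp
      rw [h, h, hY₁, hY₂, indicator_of_notMem hu, indicator_of_notMem hu]
      simp
  -- Normals are given only on `P`, that is for `u⁰ ≤ 0`, with no continuity. `Y₁` and `Y₂` are
  -- written without `N`, so they are continuous on the whole plane and need to match the integrands
  -- only on the half plane.
  have hNφ : ∀ u ∈ φ.source, u 0 ≤ 0 → IsUnitNormal S (φ.toFun u) (N (φ.toFun u)) :=
    fun u hu hu0 => hN _ ((hφ u hu).2 hu0)
  obtain ⟨i1, e1⟩ := integral_patch_eq (Q := fun p => ρ p • meanCurvature S p (N p) • N p)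
    hP hφ hCs (fun p hp hpC => by rw [(hout p (hP.subset hp) hpC).1, zero_smul]) hY₁s hY₁c
    (fun u hu => indicator_of_notMem hu _) (fun u hu hu0 => by
      rw [hY₁, indicator_of_mem hu, sum_fderiv_flux (hNφ u hu hu0) hu,
        meanCurvature_eq_traceCurvature (hNφ u hu hu0) hu, smul_comm, mul_smul])
  obtain ⟨i2, e2⟩ := integral_patch_eq (Q := tangentialGradient N ρ) hP hφ hCs
    (fun p hp hpC => by
      rw [tangentialGradient, gradient, (hout p (hP.subset hp) hpC).2]
      simp) hY₂s hY₂c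
    (fun u hu => indicator_of_notMem hu _) (fun u hu hu0 => by
      rw [hY₂, indicator_of_mem hu, tangentialGradient,
        ← sum_inner_smul_flux (hNφ u hu hu0) hu (∇ ρ (φ.toFun u))]
      simp only [gradient, InnerProductSpace.toDual_symm_apply])
  obtain ⟨i3, e3⟩ := integral_contour_eq (Q := fun p => ρ p • n p) (Y := fun t => X 0 !₂[0, t])
    hP hφ hCs (fun p hp hpC => by rw [(hout p (hP.subset hp) hpC).1, zero_smul])
    ((hXs 0).continuous.comp (by fun_prop))
    ((hXc 0).comp_isClosedEmbedding (isClosedEmbedding_planeMk_right 0))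
    (fun t ht => indicator_of_notMem ht _) (fun t ht => by
      have hc : φ.toFun !₂[0, t] ∈ contour S P := (toFun_mem_contour_iff hφ ht).2 (by simp)
      simp only [hX]
      rw [indicator_of_mem ht, flux_zero_eq_norm_smul (hn _ hc) hφ ht hc, smul_comm])
  refine ⟨i1, i2, i3, ?_⟩
  rw [e1, e2, e3, ← integral_halfPlane_divergence (hXs 0) (hXc 0) (hXs 1) (hXc 1),
    ← integral_add (hY₁s.integrable_of_hasCompactSupport hY₁c).integrableOn
      (hY₂s.integrable_of_hasCompactSupport hY₂c).integrableOn]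
  simp_rw [hdiv]

end LocalIdentity

/-! ### Partition of unity and summation -/

section Globalization

open Filter
open scoped Topology Gradient

/-- A regular patch has a smooth partition of unity subordinate to adapted charts. -/
theorem IsRegularPatch.exists_partition {S P : Set Space} (hP : IsRegularPatch S P) :
    ∃ (ι : Type) (_ : Fintype ι) (ρ : ι → Space → ℝ), (∀ i, ContDiff ℝ ∞ (ρ i)) ∧
      (∀ p ∈ P, ∀ᶠ q in 𝓝 p, ∑ i, ρ i q = 1) ∧
      ∀ i, ∃ φ : SurfaceChart S, φ.IsAdapted P ∧ ∃ C : Set Plane, IsCompact C ∧ C ⊆ φ.source ∧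
        S ∩ tsupport (ρ i) ⊆ φ.toFun '' C := by
  have hloc : ∀ p : P, ∃ O : Set Space, IsOpen O ∧ p.1 ∈ O ∧ ∃ φ : SurfaceChart S,
      φ.IsAdapted P ∧ ∃ C : Set Plane, IsCompact C ∧ C ⊆ φ.source ∧ S ∩ O ⊆ φ.toFun '' C := by
    rintro ⟨p, hp⟩
    obtain ⟨φ, hφ, u, hu, rfl⟩ := hP.exists_adapted p hp
    obtain ⟨C, hC, huC, hCs⟩ := exists_compact_subset φ.isOpen_source hu
    have h := SurfaceChart.image_mem_nhdsWithin hu (mem_interior_iff_mem_nhds.1 huC)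
    obtain ⟨O, hO, huO, hOC⟩ := mem_nhdsWithin.1 h
    refine ⟨O, hO, huO, φ, hφ, C, hC, hCs, fun q hq => ?_⟩
    exact image_mono inter_subset_right (hOC ⟨hq.2, hq.1⟩)
  choose O hO hpO hchart using hloc
  obtain ⟨t, ht⟩ := hP.isCompact.elim_finite_subcover O hO
    fun p hp => mem_iUnion.2 ⟨⟨p, hp⟩, hpO ⟨p, hp⟩⟩
  -- The partition is taken on a closed thickening of `P`, so that its sum is `1` near each point of
  -- `P` and not merely on `P`. Only then can the sum be differentiated in all directions.
  obtain ⟨δ, hδ, hδt⟩ := hP.isCompact.exists_cthickening_subset_open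
    (isOpen_biUnion fun i _ => hO i) ht
  obtain ⟨ρ, hρ⟩ := SmoothPartitionOfUnity.exists_isSubordinate (ι := t)
    (modelWithCornersSelf ℝ Space) (Metric.isClosed_cthickening (δ := δ) (E := P)) (fun i => O i) (fun i => hO i)
    (by simpa [iUnion_subtype] using hδt)
  refine ⟨t, inferInstance, fun i => ρ i, fun i => (ρ i).contMDiff.contDiff, fun p hp => ?_,
    fun i => ?_⟩
  · filter_upwards [(Metric.isOpen_thickening (δ := δ) (E := P)).mem_nhds
      (Metric.self_subset_thickening hδ P hp)] with q hq
    have := ρ.sum_eq_one (Metric.thickening_subset_cthickening δ P hq)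
    rwa [finsum_eq_sum_of_fintype] at this
  · obtain ⟨φ, hφ, C, hC, hCs, hOC⟩ := hchart i
    exact ⟨φ, hφ, C, hC, hCs, (inter_subset_inter_right S (hρ i)).trans hOC⟩

/-- The gradient of a locally constant sum vanishes, and the tangential part is linear in the
gradient. This removes the error terms created by the cutoffs. -/
theorem sum_tangentialGradient_eq_zero {ι : Type*} [Fintype ι] {ρ : ι → Space → ℝ}
    (hρ : ∀ i, ContDiff ℝ ∞ (ρ i)) {p : Space} (h : ∀ᶠ q in 𝓝 p, ∑ i, ρ i q = 1)
    (N : Space → Space) : ∑ i, tangentialGradient N (ρ i) p = 0 := by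
  have hd : ∑ i, fderiv ℝ (ρ i) p = 0 := by
    rw [← fderiv_fun_sum fun i _ => (hρ i).differentiable (by simp) p]
    have h' : (fun q => ∑ i, ρ i q) =ᶠ[𝓝 p] fun _ => 1 := h
    rw [h'.fderiv_eq]
    simp
  have hg : ∑ i, ∇ (ρ i) p = 0 := by
    simp only [gradient]
    rw [← map_sum, hd, map_zero]
  simp only [tangentialGradient]
  rw [Finset.sum_sub_distrib, ← Finset.sum_smul, ← inner_sum, hg]
  simp

end Globalization

/-- `μHE[2]` and `μHE[1]` are the Euclidean Hausdorff measures: area and arc length. -/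
theorem mainTheorem1 (S P : Set Space) (hS : IsSmoothSurface S) (hP : IsRegularPatch S P)
    (N : Space → Space) (hN : ∀ p ∈ P, IsUnitNormal S p (N p))
    (n : Space → Space) (hn : ∀ p ∈ contour S P, IsOutwardConormal S P p (n p)) :
    IntegrableOn (fun p => meanCurvature S p (N p) • N p) P μHE[2] ∧
    IntegrableOn n (contour S P) μHE[1] ∧
    ∫ p in P, meanCurvature S p (N p) • N p ∂μHE[2] = ∫ p in contour S P, n p ∂μHE[1] := by
  obtain ⟨ι, _, ρ, hρ, hsum, hchart⟩ := hP.exists_partition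
  choose φ hφ C hC hCs hρC using hchart
  have key := fun i => integral_smul_meanCurvature_add_tangentialGradient hP hN hn (hφ i) (hC i)
    (hCs i) (hρ i) (hρC i)
  have hPm : MeasurableSet P := hP.isCompact.isClosed.measurableSet
  have hΓm : MeasurableSet (contour S P) :=
    (hP.isCompact.isClosed.inter isClosed_closure).measurableSet
  have h1 : ∀ p ∈ P, ∑ i, ρ i p = 1 := fun p hp => (hsum p hp).self_of_nhds
  have eP : EqOn (fun p => ∑ i, ρ i p • meanCurvature S p (N p) • N p)
      (fun p => meanCurvature S p (N p) • N p) P := fun p hp => by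
    simp only
    rw [← Finset.sum_smul, h1 p hp, one_smul]
  have eΓ : EqOn (fun p => ∑ i, ρ i p • n p) n (contour S P) := fun p hp => by
    simp only
    rw [← Finset.sum_smul, h1 p hp.1, one_smul]
  -- The individual error integrals need not vanish; their integrands sum to zero pointwise on `P`.
  have e0 : ∑ i, ∫ p in P, tangentialGradient N (ρ i) p ∂μHE[2] = 0 := by
    rw [← integral_finsetSum _ fun i _ => (key i).2.1]
    refine setIntegral_eq_zero_of_forall_eq_zero fun p hp => ?_
    exact sum_tangentialGradient_eq_zero hρ (hsum p hp) N
  refine ⟨?_, ?_, ?_⟩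
  · exact (integrableOn_congr_fun eP hPm).1 (integrable_finsetSum _ fun i _ => (key i).1)
  · exact (integrableOn_congr_fun eΓ hΓm).1 (integrable_finsetSum _ fun i _ => (key i).2.2.1)
  · rw [← setIntegral_congr_fun hPm eP, ← setIntegral_congr_fun hΓm eΓ,
      integral_finsetSum _ fun i _ => (key i).1, integral_finsetSum _ fun i _ => (key i).2.2.1,
      ← Finset.sum_congr rfl fun i _ => (key i).2.2.2, Finset.sum_add_distrib, e0, add_zero]
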